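/- Let $d_1,d_2\ge 1$ and let $U,V$ be unitary operators on $\mathbb{C}^{d_1}\otimes\mathbb{C}^{d_2}$ (Alice's system and Bob's system), with unitary channels $\Psi_U(\rho)=U\rho U^\dagger$ and $\Psi_V(\rho)=V\rho V^\dagger$. Alice and Bob test the null hypothesis $H_0$, that an unknown channel is $\Psi_U$, against $H_1$, that it is $\Psi_V$. For this they choose auxiliary systems $\mathbb{C}^{e_1}$ (Alice) and $\mathbb{C}^{e_2}$ (Bob) of any dimensions, an input state $\rho$ that can be prepared by local operations and classical communication (LOCC) with respect to the partition $\mathbb{C}^{d_1}\otimes\mathbb{C}^{e_1}:\mathbb{C}^{d_2}\otimes\mathbb{C}^{e_2}$, and a measurement $\Omega=\{\Omega_0,\Omega_1\}$ that can be realized by LOCC with respect to the same partition. They accept $H_0$ on outcome $0$ and $H_1$ on outcome $1$. The error probabilities are $$p_{\mathrm I}(\Omega,\rho)=\operatorname{tr}\bigl(\Omega_1(\Psi_U\otimes\mathrm{id})(\rho)\bigr),\qquad p_{\mathrm{II}}(\Omega,\rho)=\operatorname{tr}\bigl(\Omega_0(\Psi_V\otimes\mathrm{id})(\rho)\bigr).$$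 LOCC protocols have finitely many rounds; in each round one party applies a local quantum instrument with finitely many outcomes, possibly depending on all earlier outcomes, and announces the outcome. Let $$W^{\otimes}_{d_1:d_2}(X)=\{\langle a\otimes b|X|a\otimes b\rangle : a\in\mathbb{C}^{d_1},\ b\in\mathbb{C}^{d_2},\ \|a\|=\|b\|=1\}$$ be the product numerical range, and let $z$ be the Euclidean distance from $0$ to $W^{\otimes}_{d_1:d_2}(V^\dagger U)$. Then: 1. The distance is attained: $z=\min\{|x| : x\in W^{\otimes}_{d_1:d_2}(V^\dagger U)\}$. 2. For every significance level $\delta\in[0,1]$ the minimum of $p_{\mathrm{II}}(\Omega,\rho)$ over all $e_1,e_2$ and all LOCC states $\rho$ and LOCC measurements $\Omega$ with $p_{\mathrm I}(\Omega,\rho)\le\delta$ exists and equals $$p_{\mathrm{II}}(U,V)=\begin{cases}0, & z\le\sqrt\delta,\\ \bigl(z\sqrt{1-\delta}-\sqrt{1-z^2}\,\sqrt\delta\bigr)^2, & z>\sqrt\delta.\end{cases}$$ 3. The minimum is attained without auxiliary systems, from a pure product state and with one-way communication. More precisely, let $a,b$ be any unit vectors with $|\langle a\otimes b|V^\dagger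 U|a\otimes b\rangle|=z$. For every $\delta\in[0,1]$ the input state $|a\rangle\langle a|\otimes|b\rangle\langle b|$ attains the minimum (with $p_{\mathrm I}\le\delta$) with a measurement of the following form: Alice measures in an orthonormal basis and sends her outcome $i$ to Bob, Bob measures in an orthonormal basis that depends on $i$, with outcome $j$, and the final label in $\{0,1\}$ is obtained by classical post-processing of $(i,j)$. The post-processing can be chosen deterministic if $d_1d_2\ge2$, and can be chosen to depend on $j$ only if $d_2\ge2$. -/

import Mathlib

open scoped Matrix Kronecker

namespace LocalCertification

/-! Finite-dimensional systems. A system of dimension `n` is `ℂⁿ`, operators on it are matrices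
over `Fin n`, and operators on a bipartite system `ℂᵃ ⊗ ℂᵇ` are matrices over `Fin a × Fin b`. -/

/-- Operators on the bipartite system `ℂᵃ ⊗ ℂᵇ` (first factor: Alice, second factor: Bob). -/
abbrev BiOp (a b : ℕ) : Type := Matrix (Fin a × Fin b) (Fin a × Fin b) ℂ

/-- The tensor product of two vectors. -/
def tensorVec {a b : ℕ} (x : Fin a → ℂ) (y : Fin b → ℂ) : Fin a × Fin b → ℂ :=
  fun p => x p.1 * y p.2

/-- A normalized vector, `⟨x|x⟩ = 1`. -/
def IsUnitVec {ι : Type} [Fintype ι] (x : ι → ℂ) : Prop := star x ⬝ᵥ x = 1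

/-- The rank-one operator `|x⟩⟨x|`. -/
def proj {ι : Type} (x : ι → ℂ) : Matrix ι ι ℂ := Matrix.vecMulVec x (star x)

/-- The quadratic form `⟨x|X|x⟩`. -/
def quadForm {ι : Type} [Fintype ι] (X : Matrix ι ι ℂ) (x : ι → ℂ) : ℂ := star x ⬝ᵥ (X *ᵥ x)

/-- The product numerical range of a matrix on `ℂᵃ ⊗ ℂᵇ`. -/
def productNumericalRange {a b : ℕ} (X : BiOp a b) : Set ℂ :=
  {w | ∃ (x : Fin a → ℂ) (y : Fin b → ℂ), IsUnitVec x ∧ IsUnitVec y ∧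
    w = quadForm X (tensorVec x y)}

/-- The Euclidean distance between `0` and the product numerical range. -/
noncomputable def distToZero {a b : ℕ} (X : BiOp a b) : ℝ :=
  Metric.infDist (0 : ℂ) (productNumericalRange X)

/-! ### Local operations and classical communication -/

/-- A finite LOCC protocol, as a tree. It takes a bipartite system of dimensions `a : b` to one of
dimensions `a' : b'` and issues a classical label in `O`, known to both parties. In each round one
party applies a local quantum instrument, given by Kraus operators `K k` with `∑ₖ (K k)ᴴ (K k) = 1`
(the dimension after the round may depend on the outcome), and announces the outcome `k`; the rest
of the protocol depends on all outcomes announced so far. An instrument with several Kraus operators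
per announced outcome (in particular any local channel) is the case in which the continuation does
not depend on the whole of `k`. -/
inductive Protocol (O : Type) (a' b' : ℕ) : ℕ → ℕ → Type
  | halt (o : O) : Protocol O a' b' a' b'
  | alice {a b n : ℕ} (c : Fin n → ℕ) (K : (k : Fin n) → Matrix (Fin (c k)) (Fin a) ℂ)
      (hK : ∑ k, (K k)ᴴ * K k = 1) (next : (k : Fin n) → Protocol O a' b' (c k) b) :
      Protocol O a' b' a b
  | bob {a b n : ℕ} (c : Fin n → ℕ) (K : (k : Fin n) → Matrix (Fin (c k)) (Fin b) ℂ)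
      (hK : ∑ k, (K k)ᴴ * K k = 1) (next : (k : Fin n) → Protocol O a' b' a (c k)) :
      Protocol O a' b' a b

open Classical in
/-- The quantum instrument realized by a protocol: `P.run o ρ` is the unnormalized final operator
on the event that the label is `o`, its trace being the probability of that label. -/
noncomputable def Protocol.run {O : Type} {a' b' : ℕ} :
    {a b : ℕ} → Protocol O a' b' a b → O → BiOp a b → BiOp a' b'
  | _, _, .halt o', o, ρ => if o' = o then ρ else 0
  | _, b, .alice _ K _ next, o, ρ => ∑ k, (next k).run o
      ((K k ⊗ₖ (1 : Matrix (Fin b) (Fin b) ℂ)) * ρ * (K k ⊗ₖ (1 : Matrix (Fin b) (Fin b) ℂ))ᴴ)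
  | a, _, .bob _ K _ next, o, ρ => ∑ k, (next k).run o
      (((1 : Matrix (Fin a) (Fin a) ℂ) ⊗ₖ K k) * ρ * ((1 : Matrix (Fin a) (Fin a) ℂ) ⊗ₖ K k)ᴴ)

/-- `ρ` can be prepared by LOCC, that is, by an LOCC protocol that starts from the trivial
system `ℂ : ℂ`. -/
def IsLOCCState {a b : ℕ} (ρ : BiOp a b) : Prop :=
  ∃ P : Protocol Unit a b 1 1, ρ = P.run () 1

/-- `{Ω₀, Ω₁}` is a two-outcome measurement that can be realized by LOCC: it is the statistics of
the final label of an LOCC protocol (the remaining system is discarded). -/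
def IsLOCCMeasurement {a b : ℕ} (Ω : Fin 2 → BiOp a b) : Prop :=
  ∃ (a' b' : ℕ) (P : Protocol (Fin 2) a' b' a b),
    ∀ (i : Fin 2) (σ : BiOp a b), (Ω i * σ).trace = (P.run i σ).trace

/-! ### Certification of unitary channels -/

/-- The unitary channel `ρ ↦ U ρ U†`. -/
def unitaryChannel {ι : Type} [Fintype ι] (U ρ : Matrix ι ι ℂ) : Matrix ι ι ℂ := U * ρ * Uᴴ

/-- The map `Φ ⊗ id`. -/
def tensorId {ι κ : Type} (Φ : Matrix ι ι ℂ → Matrix ι ι ℂ) (ρ : Matrix (ι × κ) (ι × κ) ℂ) :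
    Matrix (ι × κ) (ι × κ) ℂ :=
  Matrix.of fun p q => Φ (Matrix.of fun i j => ρ (i, p.2) (j, q.2)) p.1 q.1

/-- Regrouping of the four systems `(ℂ^d₁ ⊗ ℂ^d₂) ⊗ (ℂ^e₁ ⊗ ℂ^e₂)` according to the partition
`ℂ^d₁ ⊗ ℂ^e₁ : ℂ^d₂ ⊗ ℂ^e₂`. -/
def regroup (d₁ d₂ e₁ e₂ : ℕ) :
    (Fin d₁ × Fin d₂) × (Fin e₁ × Fin e₂) ≃ Fin (d₁ * e₁) × Fin (d₂ * e₂) :=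
  (Equiv.prodProdProdComm (Fin d₁) (Fin d₂) (Fin e₁) (Fin e₂)).trans
    (Equiv.prodCongr finProdFinEquiv finProdFinEquiv)

/-- The channel `Ψ_U ⊗ id` on Alice's and Bob's systems and their auxiliary systems of dimensions
`e₁` and `e₂`, as a map on operators for the partition `ℂ^d₁ ⊗ ℂ^e₁ : ℂ^d₂ ⊗ ℂ^e₂`. -/
def extendedChannel {d₁ d₂ : ℕ} (e₁ e₂ : ℕ) (U : BiOp d₁ d₂) (ρ : BiOp (d₁ * e₁) (d₂ * e₂)) :
    BiOp (d₁ * e₁) (d₂ * e₂) :=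
  Matrix.reindex (regroup d₁ d₂ e₁ e₂) (regroup d₁ d₂ e₁ e₂)
    (tensorId (unitaryChannel U)
      (Matrix.reindex (regroup d₁ d₂ e₁ e₂).symm (regroup d₁ d₂ e₁ e₂).symm ρ))

/-- Probability of the outcome with effect `E` in the state `σ`. -/
noncomputable def bornProb {ι : Type} [Fintype ι] (E σ : Matrix ι ι ℂ) : ℝ := (E * σ).trace.re

/-- The type II errors of all tests of `Ψ_U` (null hypothesis, accepted on outcome `0`) against
`Ψ_V` with LOCC input states, LOCC measurements and auxiliary systems of any dimension, whose
type I error is at most `δ`. -/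
def typeIIErrors {d₁ d₂ : ℕ} (U V : BiOp d₁ d₂) (δ : ℝ) : Set ℝ :=
  {p | ∃ (e₁ e₂ : ℕ) (ρ : BiOp (d₁ * e₁) (d₂ * e₂)) (Ω : Fin 2 → BiOp (d₁ * e₁) (d₂ * e₂)),
    IsLOCCState ρ ∧ IsLOCCMeasurement Ω ∧
    bornProb (Ω 1) (extendedChannel e₁ e₂ U ρ) ≤ δ ∧
    p = bornProb (Ω 0) (extendedChannel e₁ e₂ V ρ)}

/-- The claimed optimal type II error for distance `z` and significance level `δ`. -/
noncomputable def optimalError (z δ : ℝ) : ℝ :=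
  if z ≤ √δ then 0 else (z * √(1 - δ) - √(1 - z ^ 2) * √δ) ^ 2

/-- The two-outcome measurement with one-way communication in which Alice measures in the
orthonormal basis of columns of `R` and sends her outcome `i` to Bob, Bob measures in the
orthonormal basis of columns of `S i`, and, on Bob's outcome `j`, the final label is `k` with
probability `f i j k`. -/
noncomputable def oneWayMeasurement {d₁ d₂ : ℕ} (R : Matrix (Fin d₁) (Fin d₁) ℂ)
    (S : Fin d₁ → Matrix (Fin d₂) (Fin d₂) ℂ) (f : Fin d₁ → Fin d₂ → Fin 2 → ℝ) :
    Fin 2 → BiOp d₁ d₂ :=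
  fun k => ∑ i, ∑ j, (f i j k : ℂ) • (proj (R.col i) ⊗ₖ proj ((S i).col j))

end LocalCertification

namespace LocalCertification

/-! ### Numerical ranges and orthonormal bases -/

/-! Two facts carry the theorem: convexity of the numerical range (Toeplitz–Hausdorff), and the fact
that two orthogonal pure bipartite states can be told apart perfectly by one-way LOCC.

Lower bound. An LOCC input is separable, a sum of rank-one operators on product vectors
(`IsLOCCState.exists_eq_sum`). On a product vector with ancillas, the overlap of the two channel
outputs is a double sum of `⟨x_s ⊗ y_t|V†U|x_s ⊗ y_t⟩` over the ancilla indices. With one side fixed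
this is a sum of values of an ordinary quadratic form, and by convexity such a sum is the value at a
single vector of the same total norm. Applied once on each side, this shows that ancillas cannot
bring the overlap below `z` (`distToZero_mul_sum_le`). Of the measurement, only `Ω₀, Ω₁ ≥ 0` and `Ω₀
+ Ω₁ = 1` matter: Cauchy–Schwarz, for each effect and then over the terms of the mixture, gives `z ≤
√β √(1-α) + √(1-β) √α` for the errors `α` of type I and `β` of type II. In terms of angles this is
the triangle inequality on an arc of the unit circle, and it yields `optimalError_le`.

Attainment. A compactness argument provides a product vector with overlap `z`. Its images `φ`, `χ`
under `U`, `V` lie in a plane, and the optimal unrestricted test there projects onto an orthonormal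
pair `x`, `y` of that plane, rotated so that the type I error is at most `δ`. LOCC can implement
this test: a traceless matrix has zero diagonal in some orthonormal basis, again by convexity, and
for the right matrix this gives a basis for Alice in which Bob's conditional states from `x` and `y`
stay orthogonal (`exists_unitary_partialInner_orthogonal`). Bob then separates them. -/

/-- A positive semidefinite Hermitian 2×2 matrix of determinant zero has rank at most one, so it is
the Gram matrix of two scalars. -/
theorem exists_conj_mul_eq {a b : ℝ} (ha : 0 ≤ a) (hb : 0 ≤ b) {u : ℂ} (h : a * b = ‖u‖ ^ 2) :
    ∃ p r : ℂ, star p * p = a ∧ star r * r = b ∧ star p * r = u := by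
  have hn : ‖u‖ = √a * √b := by
    rw [← Real.sqrt_mul ha, h, Real.sqrt_sq (norm_nonneg u)]
  obtain ⟨e, he, hu⟩ : ∃ e : ℂ, star e * e = 1 ∧ u = ‖u‖ * e := by
    by_cases h0 : u = 0
    · exact ⟨1, by simp, by simp [h0]⟩
    · have h1 : (‖u‖ : ℂ) ≠ 0 := by simpa using h0
      refine ⟨u / ‖u‖, ?_, by field_simp⟩
      have : star u * u = (‖u‖ : ℂ) ^ 2 := Complex.conj_mul' u
      simp only [star_div₀, Complex.star_def, Complex.conj_ofReal] at this ⊢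
      field_simp
      exact this
  have sqa : ((√a : ℝ) : ℂ) * (√a : ℝ) = a := by
    rw [← Complex.ofReal_mul, Real.mul_self_sqrt ha]
  have sqb : ((√b : ℝ) : ℂ) * (√b : ℝ) = b := by
    rw [← Complex.ofReal_mul, Real.mul_self_sqrt hb]
  refine ⟨(√a : ℝ), (√b : ℝ) * e, by simpa using sqa, ?_, ?_⟩
  · rw [star_mul']
    calc _ = (((√b : ℝ) : ℂ) * (√b : ℝ)) * (star e * e) := by
          simp only [Complex.star_def, Complex.conj_ofReal]; ring
      _ = b := by rw [sqb, he, mul_one]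
  · rw [hu, hn]
    simp only [Complex.star_def, Complex.conj_ofReal]
    push_cast
    ring

/-- The conditions are linear in the Gram matrix of `p`, `r` and hold for the identity matrix. They
are three real equations on the four-dimensional real space of Hermitian 2×2 matrices, so some
Hermitian `H ≠ 0` solves the homogeneous system. Moving from the identity along `H` until the matrix
becomes singular keeps the conditions and gives a Gram matrix of rank one. -/
theorem exists_isotropic (m₁ m₂ m₁₂ m₂₁ n₁₂ : ℂ) (n₁ n₂ : ℝ) :
    ∃ p r : ℂ,
      star p * p * m₁ + star r * r * m₂ + star p * r * m₁₂ + star r * p * m₂₁ = m₁ + m₂ ∧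
      (star p * p * n₁ + star r * r * n₂ + star p * r * n₁₂ + star r * p * star n₁₂ : ℂ)
        = n₁ + n₂ := by
  -- A triple `(A, B, u)` encodes the Hermitian matrix with diagonal `A`, `B` and off-diagonal entry
  -- `u`.
  let L : (ℝ × ℝ × ℂ) →ₗ[ℝ] (ℂ × ℝ) :=
    { toFun := fun v => (v.1 * m₁ + v.2.1 * m₂ + v.2.2 * m₁₂ + star v.2.2 * m₂₁,
        v.1 * n₁ + v.2.1 * n₂ + 2 * (v.2.2 * n₁₂).re)
      map_add' := by
        intro v w
        ext1
        · simp only [Prod.fst_add, Prod.snd_add, star_add]; push_cast; ring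
        · simp only [Prod.fst_add, Prod.snd_add, add_mul, Complex.add_re]; ring
      map_smul' := by
        intro t v
        ext1
        · simp; ring
        · simp; ring }
  obtain ⟨v, hv, hv0⟩ : ∃ v ∈ LinearMap.ker L, v ≠ 0 := by
    apply Submodule.exists_mem_ne_zero_of_ne_bot
    apply LinearMap.ker_ne_bot_of_finrank_lt
    simp [Complex.finrank_real_complex]
  obtain ⟨A, B, u, hAB, hne, h1, h2⟩ : ∃ (A B : ℝ) (u : ℂ), A + B ≤ 0 ∧
      ¬ (A = 0 ∧ B = 0 ∧ u = 0) ∧ A * m₁ + B * m₂ + u * m₁₂ + star u * m₂₁ = 0 ∧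
      A * n₁ + B * n₂ + 2 * (u * n₁₂).re = 0 := by
    obtain ⟨A, B, u⟩ := v
    have h := LinearMap.mem_ker.1 hv
    have h1 : A * m₁ + B * m₂ + u * m₁₂ + star u * m₂₁ = 0 := congrArg Prod.fst h
    have h2 : A * n₁ + B * n₂ + 2 * (u * n₁₂).re = 0 := congrArg Prod.snd h
    have h0 : ¬ (A = 0 ∧ B = 0 ∧ u = 0) := by
      rintro ⟨rfl, rfl, rfl⟩; exact hv0 rfl
    -- The sign is chosen so that the trace is nonpositive, which forces the least eigenvalue to be
    -- negative.
    rcases le_total (A + B) 0 with hs | hs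
    · exact ⟨A, B, u, hs, h0, h1, h2⟩
    · refine ⟨-A, -B, -u, by linarith, by simpa using h0, ?_, ?_⟩
      · rw [star_neg]; push_cast; linear_combination -h1
      · simp only [neg_mul, Complex.neg_re]; linear_combination -h2
  set ρ := √(((A - B) / 2) ^ 2 + ‖u‖ ^ 2) with hρ
  have hρ2 : ρ ^ 2 = ((A - B) / 2) ^ 2 + ‖u‖ ^ 2 := Real.sq_sqrt (by positivity)
  have hρA : |(A - B) / 2| ≤ ρ := Real.abs_le_sqrt (by nlinarith [sq_nonneg ‖u‖])
  obtain ⟨hl, hr⟩ := abs_le.1 hρA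
  have hρ0 : 0 ≤ ρ := Real.sqrt_nonneg _
  -- `-t` is the least eigenvalue of `H`, so `1 + H / t` is singular and positive semidefinite.
  obtain ⟨t, ht⟩ : ∃ t, t = ρ - (A + B) / 2 := ⟨_, rfl⟩
  have htpos : 0 < t := by
    by_contra! hle
    have hs : A + B = 0 := by linarith
    have hr0 : ρ = 0 := by linarith
    rw [hr0] at hρ2
    have hu : ‖u‖ = 0 := by nlinarith [sq_nonneg ((A - B) / 2), sq_nonneg ‖u‖]
    have hd : (A - B) / 2 = 0 := by nlinarith [sq_nonneg ((A - B) / 2), sq_nonneg ‖u‖]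
    exact hne ⟨by linarith, by linarith, norm_eq_zero.1 hu⟩
  obtain ⟨p, r, hp, hr', hpr⟩ := exists_conj_mul_eq (a := (A + t) / t) (b := (B + t) / t)
    (u := u / t) (div_nonneg (by linarith) htpos.le) (div_nonneg (by linarith) htpos.le) (by
      rw [norm_div, Complex.norm_real, Real.norm_of_nonneg htpos.le, div_mul_div_comm, div_pow, sq t,
        ht]
      congr 1
      nlinarith)
  have hrp : star r * p = star u / t := by
    have := congrArg star hpr
    simpa [mul_comm] using this
  have htc : (t : ℂ) ≠ 0 := by exact_mod_cast htpos.ne'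
  refine ⟨p, r, ?_, ?_⟩
  · rw [hp, hr', hpr, hrp]
    push_cast
    field_simp
    linear_combination h1
  · rw [hp, hr', hpr, hrp]
    have h3 : (u * n₁₂ + star u * star n₁₂ : ℂ) = ((2 * (u * n₁₂).re : ℝ) : ℂ) := by
      rw [← star_mul', Complex.star_def, Complex.add_conj]
    have h4 : ((A * n₁ + B * n₂ + 2 * (u * n₁₂).re : ℝ) : ℂ) = 0 := by rw [h2]; simp
    push_cast at h3 h4 ⊢
    field_simp
    linear_combination h4 + h3

theorem quadForm_add_smul {ι : Type} [Fintype ι] (M : Matrix ι ι ℂ) (p r : ℂ) (x y : ι → ℂ) :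
    quadForm M (p • x + r • y) = star p * p * quadForm M x + star r * r * quadForm M y +
      star p * r * (star x ⬝ᵥ (M *ᵥ y)) + star r * p * (star y ⬝ᵥ (M *ᵥ x)) := by
  simp only [quadForm, star_add, star_smul, Matrix.mulVec_add, Matrix.mulVec_smul,
    add_dotProduct, dotProduct_add, smul_dotProduct, dotProduct_smul, smul_eq_mul]
  ring

/-- Convexity of the numerical range, in homogeneous form. -/
theorem exists_quadForm_eq_add {ι : Type} [Fintype ι] [DecidableEq ι] (M : Matrix ι ι ℂ)
    (C : Submodule ℂ (ι → ℂ)) {x y : ι → ℂ} (hx : x ∈ C) (hy : y ∈ C) :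
    ∃ w ∈ C, quadForm M w = quadForm M x + quadForm M y ∧
      star w ⬝ᵥ w = star x ⬝ᵥ x + star y ⬝ᵥ y := by
  have hre : ∀ v : ι → ℂ, star v ⬝ᵥ v = ((star v ⬝ᵥ v).re : ℂ) := by
    intro v
    have : star (star v ⬝ᵥ v) = star v ⬝ᵥ v :=
      (Matrix.star_dotProduct v v).symm
    exact (Complex.conj_eq_iff_re.1 this).symm
  obtain ⟨p, r, h1, h2⟩ := exists_isotropic (quadForm M x) (quadForm M y) (star x ⬝ᵥ (M *ᵥ y))
    (star y ⬝ᵥ (M *ᵥ x)) (star x ⬝ᵥ y) (star x ⬝ᵥ x).re (star y ⬝ᵥ y).re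
  refine ⟨p • x + r • y, C.add_mem (C.smul_mem _ hx) (C.smul_mem _ hy), ?_, ?_⟩
  · rw [quadForm_add_smul, h1]
  · have := quadForm_add_smul (1 : Matrix ι ι ℂ) p r x y
    simp only [quadForm, Matrix.one_mulVec] at this
    rw [this]
    rw [← hre, ← hre] at h2
    rw [← h2]
    congr 2
    rw [Matrix.star_dotProduct]

theorem exists_quadForm_eq_sum {ι κ : Type} [Fintype ι] [DecidableEq ι] (M : Matrix ι ι ℂ)
    (C : Submodule ℂ (ι → ℂ)) (s : Finset κ) (x : κ → ι → ℂ) (hx : ∀ k ∈ s, x k ∈ C) :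
    ∃ w ∈ C, quadForm M w = ∑ k ∈ s, quadForm M (x k) ∧
      star w ⬝ᵥ w = ∑ k ∈ s, star (x k) ⬝ᵥ x k := by
  classical
  induction s using Finset.induction_on with
  | empty => exact ⟨0, C.zero_mem, by simp [quadForm], by simp⟩
  | insert k s hk ih =>
    obtain ⟨w, hw, h1, h2⟩ := ih fun l hl => hx l (Finset.mem_insert_of_mem hl)
    obtain ⟨w', hw', h3, h4⟩ := exists_quadForm_eq_add M C (hx k (Finset.mem_insert_self k s)) hw
    exact ⟨w', hw', by rw [h3, h1, Finset.sum_insert hk], by rw [h4, h2, Finset.sum_insert hk]⟩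

theorem mem_unitaryGroup_iff_col {ι : Type} [Fintype ι] [DecidableEq ι] (R : Matrix ι ι ℂ) :
    R ∈ Matrix.unitaryGroup ι ℂ ↔
      ∀ i j, star (R.col i) ⬝ᵥ R.col j = if i = j then 1 else 0 := by
  rw [Matrix.mem_unitaryGroup_iff', ← Matrix.ext_iff]
  simp only [Matrix.one_apply, Matrix.mul_apply, Matrix.star_apply, dotProduct, Pi.star_apply,
    Matrix.col_apply]

theorem exists_unitary_extension {ι : Type} [Fintype ι] [DecidableEq ι] (s : Set ι)
    (v : ι → ι → ℂ)
    (h : ∀ i ∈ s, ∀ j ∈ s, star (v i) ⬝ᵥ v j = if i = j then 1 else 0) :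
    ∃ R ∈ Matrix.unitaryGroup ι ℂ, ∀ i ∈ s, R.col i = v i := by
  have hinner : ∀ x y : ι → ℂ, inner ℂ (WithLp.toLp 2 x) (WithLp.toLp 2 y) = star x ⬝ᵥ y := by
    intro x y
    rw [EuclideanSpace.inner_toLp_toLp, dotProduct_comm]
  obtain ⟨b, hb⟩ := Orthonormal.exists_orthonormalBasis_extension_of_card_eq (𝕜 := ℂ)
    (E := EuclideanSpace ℂ ι) (ι := ι) (by simp) (v := fun i => WithLp.toLp 2 (v i)) (s := s) (by
      rw [orthonormal_iff_ite]
      intro i j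
      simp only [Set.domRestrict_apply, hinner]
      rw [h i i.2 j j.2]
      simp [Subtype.ext_iff])
  refine ⟨Matrix.of fun i j => b j i, ?_, fun i hi => ?_⟩
  · rw [mem_unitaryGroup_iff_col]
    intro i j
    have := orthonormal_iff_ite.1 b.orthonormal i j
    rw [← this]
    exact (hinner (b i) (b j)).symm
  · ext j
    simp [Matrix.col_apply, hb i hi]

theorem sum_quadForm_col {ι : Type} [Fintype ι] [DecidableEq ι] (T : Matrix ι ι ℂ)
    {R : Matrix ι ι ℂ} (hR : R ∈ Matrix.unitaryGroup ι ℂ) :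
    ∑ i, quadForm T (R.col i) = T.trace := by
  have h1 : (Rᴴ * T * R).trace = T.trace := by
    rw [Matrix.mul_assoc, Matrix.trace_mul_comm, Matrix.mul_assoc]
    have : R * Rᴴ = 1 := Matrix.mem_unitaryGroup_iff.1 hR
    rw [this, mul_one]
  rw [← h1, Matrix.trace]
  refine Finset.sum_congr rfl fun i _ => ?_
  rw [quadForm, Matrix.diag_apply, Matrix.mul_assoc, Matrix.mul_apply]
  simp [dotProduct, Matrix.mulVec, Matrix.mul_apply, Matrix.col_apply]

/-- A traceless matrix has zero diagonal in some orthonormal basis. -/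
theorem exists_unitary_quadForm_col_eq_zero {n : ℕ} (T : Matrix (Fin n) (Fin n) ℂ)
    (hT : T.trace = 0) :
    ∃ R ∈ Matrix.unitaryGroup (Fin n) ℂ, ∀ i, quadForm T (R.col i) = 0 := by
  suffices h : ∀ k ≤ n, ∃ R ∈ Matrix.unitaryGroup (Fin n) ℂ,
      ∀ i : Fin n, (i : ℕ) < k → quadForm T (R.col i) = 0 by
    obtain ⟨R, hR, h⟩ := h n le_rfl
    exact ⟨R, hR, fun i => h i i.2⟩
  intro k
  induction k with
  | zero => exact fun _ => ⟨1, one_mem _, by simp⟩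
  | succ k ih =>
    intro hk
    obtain ⟨R, hR, h0⟩ := ih (by omega)
    have hcol := (mem_unitaryGroup_iff_col R).1 hR
    let C : Submodule ℂ (Fin n → ℂ) :=
      { carrier := {w | ∀ i : Fin n, (i : ℕ) < k → star (R.col i) ⬝ᵥ w = 0}
        add_mem' := fun ha hb i hi => by rw [dotProduct_add, ha i hi, hb i hi, add_zero]
        zero_mem' := fun i _ => by simp
        smul_mem' := fun c w hw i hi => by rw [dotProduct_smul, hw i hi, smul_zero] }
    -- The first `k` diagonal entries vanish and the trace is zero, so the remaining entries sum to
    -- zero. Convexity inside the orthogonal complement `C` of the first `k` columns merges the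
    -- remaining columns into one isotropic vector, of squared norm `m`, their number.
    obtain ⟨w, hw, hq, hn⟩ := exists_quadForm_eq_sum T C
      (Finset.univ.filter fun i : Fin n => k ≤ (i : ℕ)) (fun i => R.col i) (by
        intro j hj i hi
        rw [hcol, if_neg]
        rintro rfl
        simp at hj
        omega)
    have hq0 : quadForm T w = 0 := by
      rw [hq, ← hT, ← sum_quadForm_col T hR]
      refine Finset.sum_subset (Finset.subset_univ _) fun i _ hi => h0 i ?_
      simpa using hi
    set m : ℕ := (Finset.univ.filter fun i : Fin n => k ≤ (i : ℕ)).card with hm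
    have hmpos : 0 < m := Finset.card_pos.2 ⟨⟨k, by omega⟩, by simp⟩
    have hn' : star w ⬝ᵥ w = m := by
      rw [hn, Finset.sum_congr rfl fun i _ => by rw [hcol i i, if_pos rfl]]
      simp [hm]
    have hms : ((√m : ℝ) : ℂ) * (√m : ℝ) = m := by
      rw [← Complex.ofReal_mul, Real.mul_self_sqrt (by positivity)]; simp
    have hms0 : ((√m : ℝ) : ℂ) ≠ 0 := by
      simpa using hmpos.ne'
    set w' : Fin n → ℂ := ((√m : ℝ) : ℂ)⁻¹ • w with hw'
    have hstar : star w' = ((√m : ℝ) : ℂ)⁻¹ • star w := by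
      rw [hw', star_smul, star_inv₀, Complex.star_def, Complex.conj_ofReal]
    have hw1 : star w' ⬝ᵥ w' = 1 := by
      rw [hstar, hw', smul_dotProduct, dotProduct_smul, hn', ← hms]
      simp only [smul_eq_mul]
      field_simp
    have hwC : ∀ i : Fin n, (i : ℕ) < k → star (R.col i) ⬝ᵥ w' = 0 := C.smul_mem _ hw
    have hwC' : ∀ i : Fin n, (i : ℕ) < k → star w' ⬝ᵥ R.col i = 0 := fun i hi => by
      rw [Matrix.star_dotProduct, hwC i hi, star_zero]
    obtain ⟨R', hR', hext⟩ := exists_unitary_extension {i : Fin n | (i : ℕ) < k + 1}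
      (fun i => if (i : ℕ) < k then R.col i else w') (by
        intro i hi j hj
        simp only [Set.mem_ofPred_eq] at hi hj
        by_cases hik : (i : ℕ) < k <;> by_cases hjk : (j : ℕ) < k
        · simp only [hik, hjk, if_true, hcol]
        · simp only [hik, hjk, if_true, if_false, hwC i hik]
          rw [if_neg]; rintro rfl; exact hjk hik
        · simp only [hik, hjk, if_true, if_false, hwC' j hjk]
          rw [if_neg]; rintro rfl; exact hik hjk
        · simp only [hik, hjk, if_false, hw1]
          rw [if_pos (Fin.ext (by omega))])
    refine ⟨R', hR', fun i hi => ?_⟩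
    rw [hext i hi]
    by_cases hik : (i : ℕ) < k
    · simp only [hik, if_true, h0 i hik]
    · simp only [hik, if_false]
      rw [quadForm, hstar, hw', Matrix.mulVec_smul, smul_dotProduct, dotProduct_smul]
      rw [quadForm] at hq0
      rw [hq0]; simp

theorem star_dotProduct_self {ι : Type} [Fintype ι] (x : ι → ℂ) :
    star x ⬝ᵥ x = ((∑ i, ‖x i‖ ^ 2 : ℝ) : ℂ) := by
  push_cast
  exact Finset.sum_congr rfl fun i _ => Complex.conj_mul' (x i)

theorem tensorVec_dotProduct_tensorVec {a b : ℕ} (x x' : Fin a → ℂ) (y y' : Fin b → ℂ) :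
    star (tensorVec x y) ⬝ᵥ tensorVec x' y' = (star x ⬝ᵥ x') * (star y ⬝ᵥ y') := by
  simp only [dotProduct, tensorVec, Fintype.sum_prod_type, Finset.sum_mul_sum, Pi.star_apply,
    star_mul']
  exact Finset.sum_congr rfl fun i _ => Finset.sum_congr rfl fun j _ => by ring

theorem proj_kronecker_proj {a b : ℕ} (x : Fin a → ℂ) (y : Fin b → ℂ) :
    proj x ⊗ₖ proj y = proj (tensorVec x y) := by
  ext p q
  simp [proj, tensorVec, Matrix.vecMulVec_apply]
  ring

theorem quadForm_proj {ι : Type} [Fintype ι] (v x : ι → ℂ) :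
    quadForm (proj v) x = ((‖star v ⬝ᵥ x‖ ^ 2 : ℝ) : ℂ) := by
  have h : proj v *ᵥ x = (star v ⬝ᵥ x) • v := by
    ext i
    simp [proj, Matrix.vecMulVec_apply, Matrix.mulVec, dotProduct, Finset.mul_sum, mul_comm,
      mul_left_comm]
  rw [quadForm, h, dotProduct_smul, Matrix.star_dotProduct x v, smul_eq_mul, mul_comm]
  push_cast
  exact Complex.conj_mul' _

theorem trace_mul_proj {ι : Type} [Fintype ι] (E : Matrix ι ι ℂ) (x : ι → ℂ) :
    (E * proj x).trace = quadForm E x := by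
  rw [proj, Matrix.mul_vecMulVec, Matrix.trace_vecMulVec, quadForm, dotProduct_comm]

theorem mul_proj_mul_conjTranspose {ι κ : Type} [Fintype ι] (A : Matrix κ ι ℂ) (x : ι → ℂ) :
    A * proj x * Aᴴ = proj (A *ᵥ x) := by
  rw [proj, Matrix.mul_vecMulVec, Matrix.vecMulVec_mul, proj, Matrix.star_mulVec]

theorem quadForm_conjTranspose_mul_mul {ι κ : Type} [Fintype ι] [Fintype κ] (T : Matrix κ ι ℂ)
    (X : Matrix κ κ ℂ) (x : ι → ℂ) : quadForm (Tᴴ * X * T) x = quadForm X (T *ᵥ x) := by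
  rw [quadForm, quadForm, Matrix.star_mulVec, ← Matrix.mulVec_mulVec, ← Matrix.mulVec_mulVec,
    Matrix.dotProduct_mulVec, Matrix.dotProduct_mulVec]

theorem quadForm_add_matrix {ι : Type} [Fintype ι] (A B : Matrix ι ι ℂ) (x : ι → ℂ) :
    quadForm (A + B) x = quadForm A x + quadForm B x := by
  rw [quadForm, Matrix.add_mulVec, dotProduct_add]; rfl

theorem quadForm_sum_matrix {ι κ : Type} [Fintype ι] (s : Finset κ) (A : κ → Matrix ι ι ℂ)
    (x : ι → ℂ) : quadForm (∑ k ∈ s, A k) x = ∑ k ∈ s, quadForm (A k) x := by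
  rw [quadForm, Matrix.sum_mulVec, dotProduct_sum]; rfl

theorem quadForm_smul_matrix {ι : Type} [Fintype ι] (c : ℂ) (A : Matrix ι ι ℂ) (x : ι → ℂ) :
    quadForm (c • A) x = c * quadForm A x := by
  rw [quadForm, Matrix.smul_mulVec, dotProduct_smul]; rfl

theorem quadForm_oneWayMeasurement {d₁ d₂ : ℕ} (R : Matrix (Fin d₁) (Fin d₁) ℂ)
    (S : Fin d₁ → Matrix (Fin d₂) (Fin d₂) ℂ) (f : Fin d₁ → Fin d₂ → Fin 2 → ℝ) (k : Fin 2)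
    (x : Fin d₁ × Fin d₂ → ℂ) :
    quadForm (oneWayMeasurement R S f k) x =
      ((∑ i, ∑ j, f i j k * ‖star (tensorVec (R.col i) ((S i).col j)) ⬝ᵥ x‖ ^ 2 : ℝ) : ℂ) := by
  rw [oneWayMeasurement, quadForm_sum_matrix]
  push_cast
  refine Finset.sum_congr rfl fun i _ => ?_
  rw [quadForm_sum_matrix]
  refine Finset.sum_congr rfl fun j _ => ?_
  rw [quadForm_smul_matrix, proj_kronecker_proj, quadForm_proj]
  push_cast
  rfl

/-! ### Structure of LOCC protocols -/

/-- Along each branch of the tree the local Kraus operators multiply up separately on the two sides,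
so LOCC is a separable operation. The bounds on states and on effects both come from this form. -/
theorem Protocol.exists_kraus {O : Type} {a' b' a b : ℕ} (P : Protocol O a' b' a b) :
    ∀ o : O, ∃ (κ : Type) (_ : Fintype κ) (A : κ → Matrix (Fin a') (Fin a) ℂ)
      (B : κ → Matrix (Fin b') (Fin b) ℂ),
      ∀ ρ : BiOp a b, P.run o ρ = ∑ k, (A k ⊗ₖ B k) * ρ * (A k ⊗ₖ B k)ᴴ := by
  intro o
  induction P with
  | halt o' =>
    by_cases h : o' = o
    · refine ⟨Unit, inferInstance, fun _ => 1, fun _ => 1, fun ρ => ?_⟩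
      simp [Protocol.run, h]
    · refine ⟨Empty, inferInstance, fun _ => 1, fun _ => 1, fun ρ => ?_⟩
      simp [Protocol.run, h]
  | @alice a b n c K hK next ih =>
    choose κ hκ A B h using ih
    refine ⟨Σ k, κ k, inferInstance, fun p => A p.1 p.2 * K p.1, fun p => B p.1 p.2, fun ρ => ?_⟩
    rw [Protocol.run, Fintype.sum_sigma]
    refine Finset.sum_congr rfl fun k _ => ?_
    rw [h]
    refine Finset.sum_congr rfl fun l _ => ?_
    have := Matrix.mul_kronecker_mul (A k l) (K k) (B k l) (1 : Matrix (Fin b) (Fin b) ℂ)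
    rw [Matrix.mul_one] at this
    rw [this, Matrix.conjTranspose_mul]
    simp only [Matrix.mul_assoc]
  | @bob a b n c K hK next ih =>
    choose κ hκ A B h using ih
    refine ⟨Σ k, κ k, inferInstance, fun p => A p.1 p.2, fun p => B p.1 p.2 * K p.1, fun ρ => ?_⟩
    rw [Protocol.run, Fintype.sum_sigma]
    refine Finset.sum_congr rfl fun k _ => ?_
    rw [h]
    refine Finset.sum_congr rfl fun l _ => ?_
    have := Matrix.mul_kronecker_mul (A k l) (1 : Matrix (Fin a) (Fin a) ℂ) (B k l) (K k)
    rw [Matrix.mul_one] at this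
    rw [this, Matrix.conjTranspose_mul]
    simp only [Matrix.mul_assoc]

theorem trace_sum_conj_of_sum_eq_one {ι : Type} [Fintype ι] [DecidableEq ι] {n : ℕ}
    {κ : Fin n → Type} [∀ k, Fintype (κ k)]
    (L : (k : Fin n) → Matrix (κ k) ι ℂ) (hL : ∑ k, (L k)ᴴ * L k = 1) (ρ : Matrix ι ι ℂ) :
    ∑ k, (L k * ρ * (L k)ᴴ).trace = ρ.trace := by
  have : ∀ k, (L k * ρ * (L k)ᴴ).trace = ((L k)ᴴ * L k * ρ).trace := fun k => by
    rw [Matrix.trace_mul_comm, Matrix.mul_assoc]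
  simp only [this]
  rw [← Matrix.trace_sum, ← Finset.sum_mul, hL, one_mul]

theorem Protocol.sum_trace_run {O : Type} [Fintype O] {a' b' a b : ℕ}
    (P : Protocol O a' b' a b) : ∀ ρ : BiOp a b, ∑ o, (P.run o ρ).trace = ρ.trace := by
  classical
  induction P with
  | halt o' =>
    intro ρ
    simp only [Protocol.run]
    rw [Finset.sum_eq_single o']
    · simp
    · intro o _ h; simp [h.symm]
    · simp
  | alice c K hK next ih =>
    intro ρ
    simp only [Protocol.run, Matrix.trace_sum]
    rw [Finset.sum_comm]
    simp only [ih]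
    apply trace_sum_conj_of_sum_eq_one
    simp only [Matrix.conjTranspose_kronecker, ← Matrix.mul_kronecker_mul,
      Matrix.conjTranspose_one, Matrix.one_mul]
    rw [← Matrix.one_kronecker_one, ← hK]
    ext p q
    simp [Matrix.sum_apply, Finset.sum_mul]
  | bob c K hK next ih =>
    intro ρ
    simp only [Protocol.run, Matrix.trace_sum]
    rw [Finset.sum_comm]
    simp only [ih]
    apply trace_sum_conj_of_sum_eq_one
    simp only [Matrix.conjTranspose_kronecker, ← Matrix.mul_kronecker_mul,
      Matrix.conjTranspose_one, Matrix.one_mul]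
    rw [← Matrix.one_kronecker_one, ← hK]
    ext p q
    simp [Matrix.sum_apply, Finset.mul_sum]

open scoped ComplexOrder in
theorem IsLOCCMeasurement.posSemidef {a b : ℕ} {Ω : Fin 2 → BiOp a b} (h : IsLOCCMeasurement Ω)
    (i : Fin 2) : (Ω i).PosSemidef := by
  obtain ⟨a', b', P, hP⟩ := h
  obtain ⟨κ, _, A, B, hAB⟩ := P.exists_kraus i
  have : Ω i = ∑ k, (A k ⊗ₖ B k)ᴴ * (A k ⊗ₖ B k) := by
    rw [Matrix.ext_iff_trace_mul_right]
    intro σ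
    rw [hP, hAB, Matrix.trace_sum, Finset.sum_mul, Matrix.trace_sum]
    refine Finset.sum_congr rfl fun k _ => ?_
    rw [Matrix.trace_mul_comm, Matrix.mul_assoc]
  rw [this]
  exact Matrix.posSemidef_sum _ fun k _ => Matrix.posSemidef_conjTranspose_mul_self _

theorem IsLOCCMeasurement.add_eq_one {a b : ℕ} {Ω : Fin 2 → BiOp a b}
    (h : IsLOCCMeasurement Ω) : Ω 0 + Ω 1 = 1 := by
  obtain ⟨a', b', P, hP⟩ := h
  rw [Matrix.ext_iff_trace_mul_right]
  intro σ
  rw [add_mul, Matrix.trace_add, hP, hP, one_mul, ← P.sum_trace_run σ, Fin.sum_univ_two]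

/-- LOCC states are separable. -/
theorem IsLOCCState.exists_eq_sum {a b : ℕ} {ρ : BiOp a b} (h : IsLOCCState ρ) :
    ∃ (κ : Type) (_ : Fintype κ) (x : κ → Fin a → ℂ) (y : κ → Fin b → ℂ),
      ρ = ∑ k, proj (tensorVec (x k) (y k)) ∧
      ∑ k, (star (x k) ⬝ᵥ x k) * (star (y k) ⬝ᵥ y k) = 1 := by
  obtain ⟨P, rfl⟩ := h
  obtain ⟨κ, hκ, A, B, hAB⟩ := P.exists_kraus ()
  -- The initial system is one-dimensional on both sides, so each Kraus operator is a column, that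
  -- is, a vector.
  have hsum : P.run () 1 =
      ∑ k, proj (tensorVec (fun i => A k i 0) (fun j => B k j 0)) := by
    rw [hAB]
    refine Finset.sum_congr rfl fun k _ => ?_
    ext p q
    simp [Matrix.mul_apply, proj, tensorVec, Matrix.vecMulVec_apply, Fintype.sum_prod_type]
  refine ⟨κ, hκ, fun k i => A k i 0, fun k j => B k j 0, hsum, ?_⟩
  have htr := P.sum_trace_run 1
  rw [Fintype.sum_unique] at htr
  change (P.run () 1).trace = _ at htr
  rw [hsum, Matrix.trace_sum] at htr
  simp only [proj, Matrix.trace_vecMulVec] at htr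
  simp only [← tensorVec_dotProduct_tensorVec]
  rw [Matrix.trace_one] at htr
  simpa [dotProduct_comm] using htr

theorem isLOCCState_proj_tensorVec {d₁ d₂ : ℕ} {a : Fin d₁ → ℂ} {b : Fin d₂ → ℂ}
    (ha : IsUnitVec a) (hb : IsUnitVec b) : IsLOCCState (proj (tensorVec a b)) := by
  have hcol : ∀ {d : ℕ} (x : Fin d → ℂ), IsUnitVec x →
      ∑ _k : Fin 1, (Matrix.of fun i (_ : Fin 1) => x i)ᴴ * (Matrix.of fun i (_ : Fin 1) => x i) =
        (1 : Matrix (Fin 1) (Fin 1) ℂ) := by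
    intro d x hx
    ext i j
    rw [Fin.sum_univ_one, Matrix.mul_apply, Subsingleton.elim i j, Matrix.one_apply_eq]
    exact hx
  refine ⟨.alice (fun _ => d₁) (fun _ => Matrix.of fun i _ => a i) (hcol a ha) fun _ =>
    .bob (fun _ => d₂) (fun _ => Matrix.of fun i _ => b i) (hcol b hb) fun _ => .halt (), ?_⟩
  ext p q
  simp [Protocol.run, Matrix.mul_apply, proj, tensorVec, Matrix.vecMulVec_apply,
    Fintype.sum_prod_type, Matrix.one_apply, apply_ite (starRingEnd ℂ)]
  ring

theorem isLOCCMeasurement_oneWayMeasurement {d₁ d₂ : ℕ} {R : Matrix (Fin d₁) (Fin d₁) ℂ}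
    {S : Fin d₁ → Matrix (Fin d₂) (Fin d₂) ℂ} {f : Fin d₁ → Fin d₂ → Fin 2 → ℝ}
    (hR : R ∈ Matrix.unitaryGroup (Fin d₁) ℂ) (hS : ∀ i, S i ∈ Matrix.unitaryGroup (Fin d₂) ℂ)
    (hf : ∀ i j k, 0 ≤ f i j k) (hf1 : ∀ i j, f i j 0 + f i j 1 = 1) :
    IsLOCCMeasurement (oneWayMeasurement R S f) := by
  have hrow : ∀ {d : ℕ} {T : Matrix (Fin d) (Fin d) ℂ}, T ∈ Matrix.unitaryGroup (Fin d) ℂ →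
      ∑ i, (Matrix.of fun (_ : Fin 1) l => star (T l i))ᴴ *
        (Matrix.of fun (_ : Fin 1) l => star (T l i)) = 1 := by
    intro d T hT
    rw [← Matrix.mem_unitaryGroup_iff.1 hT]
    ext p q
    simp [Matrix.sum_apply, Matrix.mul_apply]
  -- The classical post-processing becomes a third round: on her remaining one-dimensional system
  -- Alice applies the scalar Kraus operators `√(f i j k)` and announces `k`.
  have hcoin : ∀ i j, ∑ k, (Matrix.of fun (_ _ : Fin 1) => ((√(f i j k) : ℝ) : ℂ))ᴴ *
      (Matrix.of fun (_ _ : Fin 1) => ((√(f i j k) : ℝ) : ℂ)) = 1 := by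
    intro i j
    ext p q
    rw [Fin.sum_univ_two, Subsingleton.elim p q, Matrix.one_apply_eq]
    simp only [Matrix.add_apply, Matrix.mul_apply, Fin.sum_univ_one, Matrix.conjTranspose_apply,
      Matrix.of_apply, Complex.star_def, Complex.conj_ofReal]
    rw [← Complex.ofReal_mul, ← Complex.ofReal_mul, Real.mul_self_sqrt (hf i j 0),
      Real.mul_self_sqrt (hf i j 1), ← Complex.ofReal_add, hf1, Complex.ofReal_one]
  refine ⟨1, 1, .alice (fun _ => 1) (fun i => Matrix.of fun _ l => star (R l i)) (hrow hR) fun i =>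
    .bob (fun _ => 1) (fun j => Matrix.of fun _ l => star (S i l j)) (hrow (hS i)) fun j =>
    .alice (fun _ => 1) (fun k => Matrix.of fun _ _ => ((√(f i j k) : ℝ) : ℂ)) (hcoin i j)
      fun k => .halt k, ?_⟩
  intro k σ
  simp only [Protocol.run, oneWayMeasurement, Finset.sum_mul, Matrix.trace_sum]
  refine Finset.sum_congr rfl fun i _ => Finset.sum_congr rfl fun j _ => ?_
  rw [Finset.sum_eq_single k (fun k' _ h => by simp [h]) (by simp)]
  simp only [if_true]
  set c : ℂ := ((√(f i j k) : ℝ) : ℂ) with hc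
  have hcc : star c * c = f i j k := by
    rw [hc, Complex.star_def, Complex.conj_ofReal, ← Complex.ofReal_mul,
      Real.mul_self_sqrt (hf i j k)]
  set A : Matrix (Fin 1) (Fin d₁) ℂ := Matrix.of fun _ l => star (R l i)
  set B : Matrix (Fin 1) (Fin d₂) ℂ := Matrix.of fun _ l => star (S i l j)
  have h1 : proj (R.col i) = Aᴴ * A := by
    ext p q; simp [A, proj, Matrix.vecMulVec_apply, Matrix.mul_apply, Matrix.col_apply]
  have h2 : proj ((S i).col j) = Bᴴ * B := by
    ext p q; simp [B, proj, Matrix.vecMulVec_apply, Matrix.mul_apply, Matrix.col_apply]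
  have h3 : (Matrix.of fun (_ _ : Fin 1) => c) = c • (1 : Matrix (Fin 1) (Fin 1) ℂ) := by
    ext p q; rw [Subsingleton.elim p q]; simp
  rw [h1, h2, h3, Matrix.mul_kronecker_mul, ← hcc]
  have h5 := Matrix.mul_kronecker_mul (1 : Matrix (Fin 1) (Fin 1) ℂ) A B
    (1 : Matrix (Fin d₂) (Fin d₂) ℂ)
  rw [Matrix.one_mul, Matrix.mul_one] at h5
  rw [← Matrix.conjTranspose_kronecker, h5, Matrix.smul_kronecker, Matrix.one_kronecker_one]
  simp only [Matrix.conjTranspose_mul, Matrix.conjTranspose_smul, Matrix.conjTranspose_one,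
    Matrix.smul_mul, Matrix.mul_smul, one_mul, mul_one, Matrix.trace_smul, smul_eq_mul, smul_smul]
  congr 1
  generalize A ⊗ₖ (1 : Matrix (Fin d₂) (Fin d₂) ℂ) = G
  generalize (1 : Matrix (Fin 1) (Fin 1) ℂ) ⊗ₖ B = H
  simp only [Matrix.mul_assoc]
  rw [← Matrix.mul_assoc Gᴴ, Matrix.trace_mul_comm]
  simp only [Matrix.mul_assoc]

/-! ### Channels with auxiliary systems -/

theorem extendedChannel_eq {d₁ d₂ : ℕ} (e₁ e₂ : ℕ) (U : BiOp d₁ d₂)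
    (ρ : BiOp (d₁ * e₁) (d₂ * e₂)) :
    extendedChannel e₁ e₂ U ρ =
      Matrix.reindex (regroup d₁ d₂ e₁ e₂) (regroup d₁ d₂ e₁ e₂)
        (U ⊗ₖ (1 : Matrix (Fin e₁ × Fin e₂) (Fin e₁ × Fin e₂) ℂ)) * ρ *
      (Matrix.reindex (regroup d₁ d₂ e₁ e₂) (regroup d₁ d₂ e₁ e₂)
        (U ⊗ₖ (1 : Matrix (Fin e₁ × Fin e₂) (Fin e₁ × Fin e₂) ℂ)))ᴴ := by
  set e := regroup d₁ d₂ e₁ e₂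
  have h : ∀ σ : Matrix ((Fin d₁ × Fin d₂) × (Fin e₁ × Fin e₂)) _ ℂ,
      tensorId (unitaryChannel U) σ = (U ⊗ₖ 1) * σ * (U ⊗ₖ 1)ᴴ := by
    intro σ
    ext ⟨p, p'⟩ ⟨q, q'⟩
    simp only [tensorId, unitaryChannel, Matrix.of_apply, Matrix.mul_apply,
      Matrix.conjTranspose_apply, Matrix.kroneckerMap_apply, Matrix.one_apply]
    rw [Fintype.sum_prod_type (α₁ := Fin d₁ × Fin d₂) (α₂ := Fin e₁ × Fin e₂)]
    refine Finset.sum_congr rfl fun i _ => ?_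
    rw [Finset.sum_eq_single q' (fun k _ hk => by simp [hk.symm]) (by simp)]
    rw [Fintype.sum_prod_type (α₁ := Fin d₁ × Fin d₂) (α₂ := Fin e₁ × Fin e₂)]
    simp
  change Matrix.reindex e e (tensorId (unitaryChannel U) (Matrix.reindex e.symm e.symm ρ)) = _
  rw [h]
  simp only [Matrix.reindex_apply, Equiv.symm_symm, Matrix.conjTranspose_submatrix]
  have : ρ = (ρ.submatrix e e).submatrix e.symm e.symm := by simp
  conv_rhs => rw [this]
  rw [Matrix.submatrix_mul_equiv, Matrix.submatrix_mul_equiv]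

theorem quadForm_reindex {ι κ : Type} [Fintype ι] [Fintype κ] (e : ι ≃ κ) (M : Matrix ι ι ℂ)
    (v : κ → ℂ) : quadForm (Matrix.reindex e e M) v = quadForm M (v ∘ e) := by
  simp only [quadForm, dotProduct, Matrix.mulVec, Matrix.reindex_apply, Matrix.submatrix_apply]
  rw [← e.sum_comp]
  refine Finset.sum_congr rfl fun i _ => ?_
  rw [← e.sum_comp]
  simp

theorem quadForm_kronecker_one {ι κ : Type} [Fintype ι] [Fintype κ] [DecidableEq κ]
    (X : Matrix ι ι ℂ) (v : ι × κ → ℂ) :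
    quadForm (X ⊗ₖ (1 : Matrix κ κ ℂ)) v = ∑ k, quadForm X fun i => v (i, k) := by
  simp only [quadForm, dotProduct, Matrix.mulVec, Matrix.kroneckerMap_apply,
    Fintype.sum_prod_type, Matrix.one_apply]
  rw [Finset.sum_comm]
  simp

/-- The ancilla indices `s` and `t` belong to different parties, so the slices of a product vector
are again product vectors, and they run over a full grid. -/
theorem quadForm_extension_tensorVec {d₁ d₂ : ℕ} (e₁ e₂ : ℕ) (X : BiOp d₁ d₂)
    (x : Fin (d₁ * e₁) → ℂ) (y : Fin (d₂ * e₂) → ℂ) :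
    quadForm (Matrix.reindex (regroup d₁ d₂ e₁ e₂) (regroup d₁ d₂ e₁ e₂) (X ⊗ₖ 1))
      (tensorVec x y) =
    ∑ s, ∑ t, quadForm X (tensorVec (fun i => x (finProdFinEquiv (i, s)))
      (fun j => y (finProdFinEquiv (j, t)))) := by
  rw [quadForm_reindex, quadForm_kronecker_one, Fintype.sum_prod_type]
  rfl

theorem reindex_mul_conjTranspose {ι κ μ : Type} [Fintype ι] [Fintype κ] [DecidableEq κ]
    [Fintype μ] (e : ι × κ ≃ μ) (U V : Matrix ι ι ℂ) :
    (Matrix.reindex e e (V ⊗ₖ (1 : Matrix κ κ ℂ)))ᴴ * Matrix.reindex e e (U ⊗ₖ 1) =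
      Matrix.reindex e e ((Vᴴ * U) ⊗ₖ 1) := by
  simp only [Matrix.reindex_apply, Matrix.conjTranspose_submatrix, Matrix.submatrix_mul_equiv,
    Matrix.conjTranspose_kronecker, ← Matrix.mul_kronecker_mul, Matrix.conjTranspose_one, mul_one]

/-! ### The product numerical range and its distance to zero -/

theorem isCompact_setOf_isUnitVec (ι : Type) [Fintype ι] :
    IsCompact {x : ι → ℂ | IsUnitVec x} := by
  refine Metric.isCompact_of_isClosed_isBounded ?_ ?_
  · exact isClosed_eq (by unfold dotProduct; fun_prop) continuous_const
  · refine (Metric.isBounded_closedBall (x := 0) (r := 1)).subset fun x hx => ?_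
    rw [mem_closedBall_zero_iff, pi_norm_le_iff_of_nonneg zero_le_one]
    intro i
    have h : (∑ i, ‖x i‖ ^ 2 : ℝ) = 1 := by
      exact_mod_cast (star_dotProduct_self x).symm.trans hx
    have h1 : ‖x i‖ ^ 2 ≤ 1 := by
      rw [← h]
      exact Finset.single_le_sum (f := fun i => ‖x i‖ ^ 2) (fun _ _ => by positivity)
        (Finset.mem_univ i)
    exact (sq_le_one_iff₀ (norm_nonneg _)).1 h1

theorem isCompact_productNumericalRange {a b : ℕ} (X : BiOp a b) :
    IsCompact (productNumericalRange X) := by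
  have h : productNumericalRange X = (fun p : (Fin a → ℂ) × (Fin b → ℂ) =>
      quadForm X (tensorVec p.1 p.2)) '' ({x | IsUnitVec x} ×ˢ {y | IsUnitVec y}) := by
    ext w
    constructor
    · rintro ⟨x, y, hx, hy, rfl⟩
      exact ⟨(x, y), ⟨hx, hy⟩, rfl⟩
    · rintro ⟨⟨x, y⟩, ⟨hx, hy⟩, rfl⟩
      exact ⟨x, y, hx, hy, rfl⟩
  rw [h]
  refine ((isCompact_setOf_isUnitVec _).prod (isCompact_setOf_isUnitVec _)).image ?_
  unfold quadForm tensorVec dotProduct Matrix.mulVec dotProduct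
  fun_prop

theorem isUnitVec_single {n : ℕ} (i : Fin n) : IsUnitVec (Pi.single i 1 : Fin n → ℂ) := by
  simp [IsUnitVec]

theorem isLeast_distToZero {a b : ℕ} (ha : 1 ≤ a) (hb : 1 ≤ b) (X : BiOp a b) :
    IsLeast ((fun w : ℂ => ‖w‖) '' productNumericalRange X) (distToZero X) := by
  have hne : (productNumericalRange X).Nonempty :=
    ⟨_, _, _, isUnitVec_single ⟨0, ha⟩, isUnitVec_single ⟨0, hb⟩, rfl⟩
  constructor
  · obtain ⟨w, hw, h⟩ := (isCompact_productNumericalRange X).exists_infDist_eq_dist hne 0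
    exact ⟨w, hw, by rw [distToZero, h, dist_zero_left]⟩
  · rintro _ ⟨w, hw, rfl⟩
    have := Metric.infDist_le_dist_of_mem (x := (0 : ℂ)) hw
    rwa [dist_zero_left] at this

theorem distToZero_nonneg {a b : ℕ} (X : BiOp a b) : 0 ≤ distToZero X := Metric.infDist_nonneg

theorem quadForm_smul {ι : Type} [Fintype ι] (M : Matrix ι ι ℂ) (c : ℂ) (x : ι → ℂ) :
    quadForm M (c • x) = star c * c * quadForm M x := by
  rw [quadForm, quadForm, star_smul, Matrix.mulVec_smul, smul_dotProduct, dotProduct_smul,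
    smul_eq_mul, smul_eq_mul, mul_assoc]

theorem re_star_dotProduct_self_nonneg {ι : Type} [Fintype ι] (x : ι → ℂ) :
    0 ≤ (star x ⬝ᵥ x).re := by
  rw [star_dotProduct_self, Complex.ofReal_re]
  positivity

theorem exists_isUnitVec_smul {ι : Type} [Fintype ι] {x : ι → ℂ} (hx : x ≠ 0) :
    ∃ u : ι → ℂ, IsUnitVec u ∧ x = ((√(star x ⬝ᵥ x).re : ℝ) : ℂ) • u := by
  set r : ℝ := √(star x ⬝ᵥ x).re with hr
  have hxx : star x ⬝ᵥ x = ((r * r : ℝ) : ℂ) := by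
    rw [hr, Real.mul_self_sqrt (re_star_dotProduct_self_nonneg x), star_dotProduct_self,
      Complex.ofReal_re]
  have hr0 : (r : ℂ) ≠ 0 := by
    intro h
    apply hx
    rw [Complex.ofReal_eq_zero] at h
    rw [h, star_dotProduct_self] at hxx
    have h0 : (∑ i, ‖x i‖ ^ 2 : ℝ) = 0 := by
      rw [zero_mul] at hxx
      exact_mod_cast hxx
    funext i
    have := (Finset.sum_eq_zero_iff_of_nonneg fun i _ => by positivity).1 h0 i (Finset.mem_univ i)
    simpa using this
  refine ⟨(r : ℂ)⁻¹ • x, ?_, ?_⟩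
  · rw [IsUnitVec, star_smul, smul_dotProduct, dotProduct_smul, hxx, star_inv₀, Complex.star_def,
      Complex.conj_ofReal]
    push_cast
    simp only [smul_eq_mul]
    field_simp
  · rw [smul_smul, mul_inv_cancel₀ hr0, one_smul]

theorem tensorVec_smul_smul {a b : ℕ} (c d : ℂ) (x : Fin a → ℂ) (y : Fin b → ℂ) :
    tensorVec (c • x) (d • y) = (c * d) • tensorVec x y := by
  ext p
  simp only [tensorVec, Pi.smul_apply, smul_eq_mul]
  ring

/-- The homogeneous form of the distance bound, needed because slices and terms of a separable
decomposition are not normalized and may vanish. -/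
theorem distToZero_mul_le {a b : ℕ} (X : BiOp a b) (x : Fin a → ℂ) (y : Fin b → ℂ) :
    distToZero X * ((star x ⬝ᵥ x).re * (star y ⬝ᵥ y).re) ≤ ‖quadForm X (tensorVec x y)‖ := by
  by_cases hx : x = 0
  · simp [hx]
  by_cases hy : y = 0
  · simp [hy]
  obtain ⟨u, hu, hxu⟩ := exists_isUnitVec_smul hx
  obtain ⟨v, hv, hyv⟩ := exists_isUnitVec_smul hy
  set r := (star x ⬝ᵥ x).re with hr
  set t := (star y ⬝ᵥ y).re with ht
  have hr0 : 0 ≤ r := re_star_dotProduct_self_nonneg x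
  have ht0 : 0 ≤ t := re_star_dotProduct_self_nonneg y
  have hmem : quadForm X (tensorVec u v) ∈ productNumericalRange X := ⟨u, v, hu, hv, rfl⟩
  have hle := Metric.infDist_le_dist_of_mem (x := (0 : ℂ)) hmem
  rw [dist_zero_left] at hle
  rw [hxu, hyv, tensorVec_smul_smul, quadForm_smul, norm_mul]
  have : ‖star (((√r : ℝ) : ℂ) * ((√t : ℝ) : ℂ)) * (((√r : ℝ) : ℂ) * ((√t : ℝ) : ℂ))‖ = r * t := by
    rw [← Complex.ofReal_mul, Complex.star_def, Complex.conj_ofReal, ← Complex.ofReal_mul,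
      Complex.norm_real, Real.norm_of_nonneg (by positivity), mul_mul_mul_comm,
      Real.mul_self_sqrt hr0, Real.mul_self_sqrt ht0]
  rw [this, mul_comm]
  exact mul_le_mul_of_nonneg_left hle (by positivity)

/-- By convexity the whole family can be replaced by one vector with the same total value and the
same total squared norm. -/
theorem mul_sum_le_norm_sum_quadForm {ι κ : Type} [Fintype ι] [Fintype κ] {z : ℝ}
    (M : Matrix ι ι ℂ) (h : ∀ x : ι → ℂ, z * (star x ⬝ᵥ x).re ≤ ‖quadForm M x‖)
    (x : κ → ι → ℂ) : z * ∑ k, (star (x k) ⬝ᵥ x k).re ≤ ‖∑ k, quadForm M (x k)‖ := by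
  classical
  obtain ⟨w, -, hq, hn⟩ := exists_quadForm_eq_sum M ⊤ Finset.univ x fun _ _ => trivial
  rw [← hq, ← Complex.re_sum, ← hn]
  exact h w

theorem exists_quadForm_tensorVec_left {a b : ℕ} (X : BiOp a b) (y : Fin b → ℂ) :
    ∃ M : Matrix (Fin a) (Fin a) ℂ, ∀ x, quadForm M x = quadForm X (tensorVec x y) := by
  -- `T` is the map `x ↦ x ⊗ y`, and the form sought is the compression `T† X T`.
  let T : Matrix (Fin a × Fin b) (Fin a) ℂ := Matrix.of fun p i => if p.1 = i then y p.2 else 0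
  refine ⟨Tᴴ * X * T, fun x => ?_⟩
  rw [quadForm_conjTranspose_mul_mul]
  congr 1
  ext p
  simp [T, Matrix.mulVec, dotProduct, tensorVec, mul_comm]

theorem exists_quadForm_tensorVec_right {a b : ℕ} (X : BiOp a b) (x : Fin a → ℂ) :
    ∃ M : Matrix (Fin b) (Fin b) ℂ, ∀ y, quadForm M y = quadForm X (tensorVec x y) := by
  let T : Matrix (Fin a × Fin b) (Fin b) ℂ := Matrix.of fun p j => if p.2 = j then x p.1 else 0
  refine ⟨Tᴴ * X * T, fun y => ?_⟩
  rw [quadForm_conjTranspose_mul_mul]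
  congr 1
  ext p
  simp [T, Matrix.mulVec, dotProduct, tensorVec]

/-- Families of vectors on either side do not bring the product numerical range closer to zero. -/
theorem distToZero_mul_sum_le {a b : ℕ} {κ μ : Type} [Fintype κ] [Fintype μ] (X : BiOp a b)
    (x : κ → Fin a → ℂ) (y : μ → Fin b → ℂ) :
    distToZero X * ((∑ s, (star (x s) ⬝ᵥ x s).re) * ∑ t, (star (y t) ⬝ᵥ y t).re) ≤
      ‖∑ s, ∑ t, quadForm X (tensorVec (x s) (y t))‖ := by
  choose M hM using fun t => exists_quadForm_tensorVec_left X (y t)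
  choose M' hM' using fun x => exists_quadForm_tensorVec_right X x
  set Y := ∑ t, (star (y t) ⬝ᵥ y t).re
  have hY : 0 ≤ Y := Finset.sum_nonneg fun t _ => re_star_dotProduct_self_nonneg _
  have hsum : ∀ x, quadForm (∑ t, M t) x = ∑ t, quadForm X (tensorVec x (y t)) := fun x => by
    rw [quadForm_sum_matrix]
    exact Finset.sum_congr rfl fun t _ => hM t x
  -- Convexity is used on Bob's side for each fixed `x`. The resulting bound is the hypothesis on
  -- the form of `∑ t, M t` that allows its use on Alice's side.
  have h := mul_sum_le_norm_sum_quadForm (z := distToZero X * Y) (∑ t, M t) (fun x => by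
    rw [hsum]
    have := mul_sum_le_norm_sum_quadForm (z := distToZero X * (star x ⬝ᵥ x).re) (M' x) (fun y => by
      rw [hM', mul_assoc]
      exact distToZero_mul_le X x y) y
    simp only [hM'] at this
    calc _ = distToZero X * (star x ⬝ᵥ x).re * Y := by ring
      _ ≤ _ := this) x
  simp only [hsum] at h
  calc _ = distToZero X * Y * ∑ s, (star (x s) ⬝ᵥ x s).re := by ring
    _ ≤ _ := h

theorem distToZero_mul_le_extension {d₁ d₂ : ℕ} (e₁ e₂ : ℕ) (X : BiOp d₁ d₂)
    (x : Fin (d₁ * e₁) → ℂ) (y : Fin (d₂ * e₂) → ℂ) :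
    distToZero X * ((star x ⬝ᵥ x).re * (star y ⬝ᵥ y).re) ≤
      ‖quadForm (Matrix.reindex (regroup d₁ d₂ e₁ e₂) (regroup d₁ d₂ e₁ e₂) (X ⊗ₖ 1))
        (tensorVec x y)‖ := by
  have hN : ∀ {d e : ℕ} (x : Fin (d * e) → ℂ), (star x ⬝ᵥ x).re =
      ∑ s : Fin e, (star (fun i => x (finProdFinEquiv (i, s))) ⬝ᵥ
        fun i => x (finProdFinEquiv (i, s))).re := by
    intro d e x
    simp only [star_dotProduct_self, Complex.ofReal_re]
    rw [← finProdFinEquiv.sum_comp, Fintype.sum_prod_type, Finset.sum_comm]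
  rw [quadForm_extension_tensorVec, hN x, hN y]
  exact distToZero_mul_sum_le X _ _

/-! ### Lower bound on the type II error -/

open scoped ComplexOrder MatrixOrder in
-- Cauchy–Schwarz for the semi-inner product `⟨Bx, By⟩`, where `E = B†B`.
theorem norm_dotProduct_mulVec_le {ι : Type} [Fintype ι] {E : Matrix ι ι ℂ} (hE : E.PosSemidef)
    (x y : ι → ℂ) :
    ‖star x ⬝ᵥ (E *ᵥ y)‖ ≤ √(quadForm E x).re * √(quadForm E y).re := by
  classical
  obtain ⟨B, rfl⟩ : ∃ B : Matrix ι ι ℂ, E = Bᴴ * B :=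
    CStarAlgebra.nonneg_iff_eq_star_mul_self.1 (Matrix.nonneg_iff_posSemidef.2 hE)
  have h : ∀ x y : ι → ℂ, star x ⬝ᵥ ((Bᴴ * B) *ᵥ y) =
      inner ℂ (WithLp.toLp 2 (B *ᵥ x)) (WithLp.toLp 2 (B *ᵥ y)) := by
    intro x y
    rw [EuclideanSpace.inner_toLp_toLp, dotProduct_comm _ (star _), Matrix.star_mulVec,
      ← Matrix.mulVec_mulVec, Matrix.dotProduct_mulVec]
  have h' : ∀ x : ι → ℂ, √(quadForm (Bᴴ * B) x).re = ‖WithLp.toLp 2 (B *ᵥ x)‖ := by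
    intro x
    rw [quadForm, h, inner_self_eq_norm_sq_to_K]
    norm_cast
    exact Real.sqrt_sq (norm_nonneg _)
  rw [h, h', h']
  exact norm_inner_le_norm _ _

open scoped ComplexOrder in
theorem quadForm_re_nonneg {ι : Type} [Fintype ι] {E : Matrix ι ι ℂ} (hE : E.PosSemidef)
    (x : ι → ℂ) : 0 ≤ (quadForm E x).re :=
  (Complex.le_def.1 (hE.dotProduct_mulVec_nonneg x)).1

/-- Let `z`, `c`, `p` be the cosines of angles `ζ`, `γ`, `θ` in the first quadrant. The hypothesis
`cos ζ ≤ cos (θ - γ)` gives `θ ≤ ζ + γ`, and the conclusion is `cos (ζ + γ) ≤ cos θ`. The proof is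
algebraic, with `m` and `n` the cosine and sine of `ζ + γ`. -/
theorem sub_le_of_le_overlap {z w c s p q : ℝ} (hz : 0 ≤ z) (hw : 0 ≤ w) (hc : 0 ≤ c)
    (hs : 0 ≤ s) (hp : 0 ≤ p) (hq : 0 ≤ q) (hzw : z ^ 2 + w ^ 2 = 1) (hcs : c ^ 2 + s ^ 2 = 1)
    (hpq : p ^ 2 + q ^ 2 = 1) (h : z ≤ p * c + q * s) : z * c - w * s ≤ p := by
  by_contra! hlt
  obtain ⟨m, hm⟩ : ∃ m, m = z * c - w * s := ⟨_, rfl⟩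
  obtain ⟨n, hn⟩ : ∃ n, n = z * s + w * c := ⟨_, rfl⟩
  have hn0 : 0 ≤ n := by rw [hn]; positivity
  rw [← hm] at hlt
  have hmn : m ^ 2 + n ^ 2 = 1 := by
    rw [hm, hn]
    linear_combination (c ^ 2 + s ^ 2) * hzw + hcs
  have hpm : p ^ 2 < m ^ 2 := pow_lt_pow_left₀ hlt hp two_ne_zero
  have hnq : n < q := lt_of_pow_lt_pow_left₀ 2 hq (by linarith)
  have hz' : z = m * c + n * s := by
    rw [hm, hn]
    linear_combination (-z) * hcs
  have hw' : c * n - s * m = w := by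
    rw [hm, hn]
    linear_combination w * hcs
  have hfac : (z - (p * c + q * s)) * (q + n) = (m - p) * (c * (q + n) - s * (m + p)) := by
    rw [hz']
    linear_combination s * hmn - s * hpq
  -- The expression equals `c (q - n) + s (m - p) + 2 w`, and `c`, `s` do not both vanish.
  have hpos : 0 < c * (q + n) - s * (m + p) := by
    have h1 : 0 ≤ c * (q - n) := mul_nonneg hc (by linarith)
    have h2 : 0 ≤ s * (m - p) := mul_nonneg hs (by linarith)
    rcases hc.eq_or_lt with h0 | h0
    · have hs0 : 0 < s := hs.lt_of_ne' fun h3 => by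
        rw [← h0, h3] at hcs
        norm_num at hcs
      have := mul_pos hs0 (sub_pos.2 hlt)
      linarith
    · have := mul_pos h0 (sub_pos.2 hnq)
      linarith
  have h1 : 0 < (z - (p * c + q * s)) * (q + n) := hfac ▸ mul_pos (by linarith) hpos
  have := pos_of_mul_pos_left h1 (by linarith)
  linarith

/-- This makes the base of the square in `optimalError` nonnegative, so that inequalities between
bases may be squared. -/
theorem mul_sqrt_le_mul_sqrt {z δ : ℝ} (hδ0 : 0 ≤ δ) (hδ1 : δ ≤ 1) (hzδ : √δ ≤ z) (hz1 : z ≤ 1) :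
    √(1 - z ^ 2) * √δ ≤ z * √(1 - δ) := by
  have hz : 0 ≤ z := (Real.sqrt_nonneg δ).trans hzδ
  have hsq : δ ≤ z ^ 2 := by
    rw [← Real.sq_sqrt hδ0]
    exact pow_le_pow_left₀ (Real.sqrt_nonneg δ) hzδ 2
  refine le_of_sq_le_sq ?_ (mul_nonneg hz (Real.sqrt_nonneg _))
  rw [mul_pow, mul_pow, Real.sq_sqrt (by nlinarith), Real.sq_sqrt hδ0,
    Real.sq_sqrt (by linarith)]
  linarith

theorem optimalError_le {z δ α a β b : ℝ} (hz : 0 ≤ z) (hα : 0 ≤ α) (ha : 0 ≤ a)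
    (hβ : 0 ≤ β) (hb : 0 ≤ b) (hαa : a + α = 1) (hβb : β + b = 1) (hδ : α ≤ δ) (hδ1 : δ ≤ 1)
    (h : z ≤ √β * √a + √b * √α) : optimalError z δ ≤ β := by
  rw [optimalError]
  split_ifs with hzδ
  · exact hβ
  push Not at hzδ
  have ep := Real.sq_sqrt hβ
  have eq := Real.sq_sqrt hb
  have ec := Real.sq_sqrt ha
  have es := Real.sq_sqrt hα
  -- The overlap bound is at most `(β + a + b + α) / 2 = 1` by the arithmetic-geometric mean
  -- inequality.
  have hz1 : z ≤ 1 := by nlinarith [sq_nonneg (√β - √a), sq_nonneg (√b - √α)]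
  have ew := Real.sq_sqrt (show 0 ≤ 1 - z ^ 2 by nlinarith)
  have hpos := mul_sqrt_le_mul_sqrt (hα.trans hδ) hδ1 hzδ.le hz1
  have hcδ : z * √(1 - δ) ≤ z * √a :=
    mul_le_mul_of_nonneg_left (Real.sqrt_le_sqrt (by linarith)) hz
  have hsδ : √(1 - z ^ 2) * √α ≤ √(1 - z ^ 2) * √δ :=
    mul_le_mul_of_nonneg_left (Real.sqrt_le_sqrt hδ) (Real.sqrt_nonneg _)
  have hle := sub_le_of_le_overlap hz (Real.sqrt_nonneg (1 - z ^ 2)) (Real.sqrt_nonneg a)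
    (Real.sqrt_nonneg α) (Real.sqrt_nonneg β) (Real.sqrt_nonneg b) (by linarith) (by linarith)
    (by linarith) h
  calc _ ≤ √β ^ 2 := pow_le_pow_left₀ (by linarith) (by linarith) 2
    _ = β := ep

theorem optimalError_le_of_mem_typeIIErrors {d₁ d₂ : ℕ} {U V : BiOp d₁ d₂}
    (hU : U ∈ Matrix.unitaryGroup (Fin d₁ × Fin d₂) ℂ)
    (hV : V ∈ Matrix.unitaryGroup (Fin d₁ × Fin d₂) ℂ) {δ : ℝ} (hδ : δ ≤ 1) {p : ℝ}
    (hp : p ∈ typeIIErrors U V δ) : optimalError (distToZero (Vᴴ * U)) δ ≤ p := by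
  obtain ⟨e₁, e₂, ρ, Ω, hρ, hΩ, hI, rfl⟩ := hp
  obtain ⟨κ, _, x, y, rfl, hn⟩ := hρ.exists_eq_sum
  set e := regroup d₁ d₂ e₁ e₂ with he
  have hborn : ∀ (k : Fin 2) (W : BiOp d₁ d₂),
      bornProb (Ω k) (extendedChannel e₁ e₂ W (∑ k, proj (tensorVec (x k) (y k)))) =
      ∑ l, (quadForm (Ω k) (Matrix.reindex e e (W ⊗ₖ 1) *ᵥ tensorVec (x l) (y l))).re := by
    intro k W
    rw [extendedChannel_eq, Finset.mul_sum, Finset.sum_mul, bornProb, Finset.mul_sum,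
      Matrix.trace_sum, Complex.re_sum]
    simp only [mul_proj_mul_conjTranspose, trace_mul_proj, ← he]
  have hunit : ∀ W : BiOp d₁ d₂, W ∈ Matrix.unitaryGroup (Fin d₁ × Fin d₂) ℂ → ∀ l,
      (quadForm (Ω 0) (Matrix.reindex e e (W ⊗ₖ 1) *ᵥ tensorVec (x l) (y l))).re +
      (quadForm (Ω 1) (Matrix.reindex e e (W ⊗ₖ 1) *ᵥ tensorVec (x l) (y l))).re =
      (star (x l) ⬝ᵥ x l).re * (star (y l) ⬝ᵥ y l).re := by
    intro W hW l
    have hWW : Wᴴ * W = 1 := Matrix.mem_unitaryGroup_iff'.1 hW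
    rw [← Complex.add_re, ← quadForm_add_matrix, hΩ.add_eq_one, ← quadForm_conjTranspose_mul_mul,
      Matrix.mul_one, reindex_mul_conjTranspose, hWW, Matrix.one_kronecker_one]
    simp only [Matrix.reindex_apply, Matrix.submatrix_one_equiv, quadForm, Matrix.one_mulVec]
    rw [tensorVec_dotProduct_tensorVec, star_dotProduct_self, star_dotProduct_self,
      ← Complex.ofReal_mul]
    simp only [Complex.ofReal_re]
  have hn' : ∑ l, (star (x l) ⬝ᵥ x l).re * (star (y l) ⬝ᵥ y l).re = 1 := by
    have := congrArg Complex.re hn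
    rw [Complex.re_sum, Complex.one_re] at this
    rw [← this]
    refine Finset.sum_congr rfl fun l _ => ?_
    rw [star_dotProduct_self, star_dotProduct_self, ← Complex.ofReal_mul]
    simp only [Complex.ofReal_re]
  rw [hborn] at hI ⊢
  set φ := fun l => Matrix.reindex e e (U ⊗ₖ 1) *ᵥ tensorVec (x l) (y l)
  set χ := fun l => Matrix.reindex e e (V ⊗ₖ 1) *ᵥ tensorVec (x l) (y l)
  have hnn : ∀ (k : Fin 2) v, 0 ≤ (quadForm (Ω k) v).re := fun k =>
    quadForm_re_nonneg (hΩ.posSemidef k)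
  -- Inserting `Ω 0 + Ω 1 = 1` splits the overlap of the two outputs into one term for each effect.
  have hover : ∀ l, distToZero (Vᴴ * U) * ((star (x l) ⬝ᵥ x l).re * (star (y l) ⬝ᵥ y l).re) ≤
      √(quadForm (Ω 0) (χ l)).re * √(quadForm (Ω 0) (φ l)).re +
      √(quadForm (Ω 1) (χ l)).re * √(quadForm (Ω 1) (φ l)).re := by
    intro l
    refine (distToZero_mul_le_extension e₁ e₂ (Vᴴ * U) (x l) (y l)).trans ?_
    have h1 : quadForm (Matrix.reindex e e ((Vᴴ * U) ⊗ₖ 1)) (tensorVec (x l) (y l)) =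
        star (χ l) ⬝ᵥ (Ω 0 *ᵥ φ l) + star (χ l) ⬝ᵥ (Ω 1 *ᵥ φ l) := by
      rw [← dotProduct_add, ← Matrix.add_mulVec, hΩ.add_eq_one, Matrix.one_mulVec,
        ← reindex_mul_conjTranspose, quadForm, ← Matrix.mulVec_mulVec, Matrix.dotProduct_mulVec,
        ← Matrix.star_mulVec]
    rw [h1]
    exact (norm_add_le _ _).trans (add_le_add
      (norm_dotProduct_mulVec_le (hΩ.posSemidef 0) _ _)
      (norm_dotProduct_mulVec_le (hΩ.posSemidef 1) _ _))
  refine optimalError_le (α := ∑ l, (quadForm (Ω 1) (φ l)).re)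
    (a := ∑ l, (quadForm (Ω 0) (φ l)).re) (b := ∑ l, (quadForm (Ω 1) (χ l)).re)
    (distToZero_nonneg _) (Finset.sum_nonneg fun l _ => hnn 1 _)
    (Finset.sum_nonneg fun l _ => hnn 0 _) (Finset.sum_nonneg fun l _ => hnn 0 _)
    (Finset.sum_nonneg fun l _ => hnn 1 _) ?_ ?_ hI hδ ?_
  · rw [← Finset.sum_add_distrib, ← hn']
    exact Finset.sum_congr rfl fun l _ => hunit U hU l
  · rw [← Finset.sum_add_distrib, ← hn']
    exact Finset.sum_congr rfl fun l _ => hunit V hV l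
  -- The weights of the product terms add up to 1; a second Cauchy–Schwarz, over `l`, replaces the
  -- errors of the single terms by the total errors.
  · calc distToZero (Vᴴ * U) = ∑ l, distToZero (Vᴴ * U) *
          ((star (x l) ⬝ᵥ x l).re * (star (y l) ⬝ᵥ y l).re) := by
          rw [← Finset.mul_sum, hn', mul_one]
      _ ≤ _ := Finset.sum_le_sum fun l _ => hover l
      _ ≤ _ := by
          rw [Finset.sum_add_distrib]
          exact add_le_add
            (Real.sum_sqrt_mul_sqrt_le _ (fun l => hnn 0 _) fun l => hnn 0 _)
            (Real.sum_sqrt_mul_sqrt_le _ (fun l => hnn 1 _) fun l => hnn 1 _)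

/-! ### Perfect one-way discrimination of two orthogonal states -/

/-- Any orthonormal basis whose vector `i₀` is parallel to `u` works. If `u = 0`, the basis is
instead aligned with `v` at the second index `i₁`. -/
theorem exists_unitary_col_zero {n : ℕ} {i₀ i₁ : Fin n} (hi : i₀ ≠ i₁) {u v : Fin n → ℂ}
    (huv : star u ⬝ᵥ v = 0) :
    ∃ S ∈ Matrix.unitaryGroup (Fin n) ℂ, star (S.col i₀) ⬝ᵥ v = 0 ∧
      ∀ j ≠ i₀, star (S.col j) ⬝ᵥ u = 0 := by
  have hext : ∀ {x : Fin n → ℂ}, x ≠ 0 → ∀ i, ∃ S ∈ Matrix.unitaryGroup (Fin n) ℂ, ∃ c : ℂ,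
      x = c • S.col i ∧ c ≠ 0 := by
    intro x hx i
    obtain ⟨w, hw, hxw⟩ := exists_isUnitVec_smul hx
    obtain ⟨S, hS, hSi⟩ := exists_unitary_extension {i} (fun _ => w) (by
      rintro j rfl k rfl
      rw [if_pos rfl]
      exact hw)
    refine ⟨S, hS, _, by rw [hSi i rfl]; exact hxw, fun h0 => hx ?_⟩
    rw [hxw, h0, zero_smul]
  by_cases hu : u = 0
  · subst hu
    by_cases hv : v = 0
    · subst hv
      exact ⟨1, one_mem _, by simp, by simp⟩
    · obtain ⟨S, hS, c, hc, -⟩ := hext hv i₁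
      refine ⟨S, hS, ?_, by simp⟩
      rw [hc, dotProduct_smul, (mem_unitaryGroup_iff_col S).1 hS, if_neg hi, smul_zero]
  · obtain ⟨S, hS, c, hc, hc0⟩ := hext hu i₀
    refine ⟨S, hS, ?_, fun j hj => ?_⟩
    · rw [hc, star_smul, smul_dotProduct, smul_eq_mul] at huv
      exact (mul_eq_zero.1 huv).resolve_left (star_ne_zero.2 hc0)
    · rw [hc, dotProduct_smul, (mem_unitaryGroup_iff_col S).1 hS, if_neg hj, smul_zero]

/-- Bob's unnormalized state when Alice finds `r`. -/
def partialInner {a b : ℕ} (r : Fin a → ℂ) (x : Fin a × Fin b → ℂ) : Fin b → ℂ :=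
  fun j => ∑ i, star (r i) * x (i, j)

theorem star_tensorVec_dotProduct {a b : ℕ} (r : Fin a → ℂ) (s : Fin b → ℂ)
    (x : Fin a × Fin b → ℂ) :
    star (tensorVec r s) ⬝ᵥ x = star s ⬝ᵥ partialInner r x := by
  simp only [dotProduct, tensorVec, partialInner, Fintype.sum_prod_type, Finset.mul_sum,
    Pi.star_apply, star_mul']
  rw [Finset.sum_comm]
  exact Finset.sum_congr rfl fun i _ => Finset.sum_congr rfl fun j _ => by ring

/-- Alice can choose a basis for which Bob's conditional states remain orthogonal. -/
theorem exists_unitary_partialInner_orthogonal {a b : ℕ} {x y : Fin a × Fin b → ℂ}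
    (h : star x ⬝ᵥ y = 0) :
    ∃ R ∈ Matrix.unitaryGroup (Fin a) ℂ, ∀ i,
      star (partialInner (R.col i) x) ⬝ᵥ partialInner (R.col i) y = 0 := by
  -- The form of `T` at `r` is the overlap of Bob's conditional states when Alice finds `r`, and its
  -- trace is `⟨x|y⟩ = 0`.
  let T : Matrix (Fin a) (Fin a) ℂ := Matrix.of fun i i' => ∑ j, y (i, j) * star (x (i', j))
  have hT : T.trace = 0 := by
    rw [← h]
    simp only [Matrix.trace, T, Matrix.diag_apply, Matrix.of_apply, dotProduct,
      Fintype.sum_prod_type, Pi.star_apply]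
    exact Finset.sum_congr rfl fun i _ => Finset.sum_congr rfl fun j _ => mul_comm _ _
  obtain ⟨R, hR, h0⟩ := exists_unitary_quadForm_col_eq_zero T hT
  refine ⟨R, hR, fun i => ?_⟩
  rw [← h0 i]
  generalize R.col i = r
  simp only [quadForm, Matrix.mulVec, dotProduct, partialInner, T, Matrix.of_apply, Pi.star_apply,
    star_sum, star_mul', star_star, Finset.sum_mul, Finset.mul_sum]
  rw [Finset.sum_comm]
  refine Finset.sum_congr rfl fun k _ => ?_
  rw [Finset.sum_comm]
  exact Finset.sum_congr rfl fun l _ => Finset.sum_congr rfl fun j _ => by ring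

/-- Bob aligns his basis with the two orthogonal conditional states, always assigning his outcome 0
to `x` and all others to `y`; hence the label ignores `i`. If `n₂ = 1`, Bob has nothing to measure
and Alice discriminates alone. -/
theorem exists_oneWay_discrimination {n₁ n₂ : ℕ} (hn : 2 ≤ n₁ * n₂) {x y : Fin n₁ × Fin n₂ → ℂ}
    (h : star x ⬝ᵥ y = 0) :
    ∃ (R : Matrix (Fin n₁) (Fin n₁) ℂ) (S : Fin n₁ → Matrix (Fin n₂) (Fin n₂) ℂ)
      (g : Fin n₁ → Fin n₂ → Fin 2),
      R ∈ Matrix.unitaryGroup (Fin n₁) ℂ ∧ (∀ i, S i ∈ Matrix.unitaryGroup (Fin n₂) ℂ) ∧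
      (2 ≤ n₂ → ∀ i i', g i = g i') ∧
      ∀ i j, (g i j = 0 → star (tensorVec (R.col i) ((S i).col j)) ⬝ᵥ y = 0) ∧
        (g i j = 1 → star (tensorVec (R.col i) ((S i).col j)) ⬝ᵥ x = 0) := by
  by_cases h2 : 2 ≤ n₂
  · obtain ⟨R, hR, hort⟩ := exists_unitary_partialInner_orthogonal h
    have hne : (⟨0, by omega⟩ : Fin n₂) ≠ ⟨1, by omega⟩ := by simp
    choose S hS h0 h1 using fun i => exists_unitary_col_zero hne (hort i)
    refine ⟨R, S, fun _ j => if j = ⟨0, by omega⟩ then 0 else 1, hR, hS, fun _ _ _ => rfl,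
      fun i j => ⟨fun hg => ?_, fun hg => ?_⟩⟩
    · rw [star_tensorVec_dotProduct]
      by_cases hj : j = ⟨0, by omega⟩
      · rw [hj]; exact h0 i
      · simp [hj] at hg
    · rw [star_tensorVec_dotProduct]
      by_cases hj : j = ⟨0, by omega⟩
      · simp [hj] at hg
      · exact h1 i j hj
  · obtain rfl : n₂ = 1 := by
      rcases Nat.eq_zero_or_pos n₂ with h0 | h0
      · simp [h0] at hn
      · omega
    have h1 : 2 ≤ n₁ := by omega
    have hne : (⟨0, by omega⟩ : Fin n₁) ≠ ⟨1, by omega⟩ := by simp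
    have hval : ∀ (r : Fin n₁ → ℂ) (j : Fin 1) (v : Fin n₁ × Fin 1 → ℂ),
        star (tensorVec r ((1 : Matrix (Fin 1) (Fin 1) ℂ).col j)) ⬝ᵥ v =
          star r ⬝ᵥ fun i => v (i, 0) := by
      intro r j v
      simp [dotProduct, tensorVec, Fintype.sum_prod_type, Matrix.col_apply,
        Subsingleton.elim j 0]
    obtain ⟨R, hR, h0, h1⟩ := exists_unitary_col_zero hne (u := fun i => x (i, 0))
      (v := fun i => y (i, 0)) (by
        rw [← h]
        simp [dotProduct, Fintype.sum_prod_type])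
    refine ⟨R, fun _ => 1, fun i _ => if i = ⟨0, by omega⟩ then 0 else 1, hR, fun _ => one_mem _,
      fun h => by omega, fun i j => ⟨fun hg => ?_, fun hg => ?_⟩⟩
    · rw [hval]
      by_cases hi : i = ⟨0, by omega⟩
      · rw [hi]; exact h0
      · simp [hi] at hg
    · rw [hval]
      by_cases hi : i = ⟨0, by omega⟩
      · simp [hi] at hg
      · exact h1 i hi

/-! ### Optimal tests with one-way communication -/

theorem bornProb_oneWayMeasurement {d₁ d₂ : ℕ} (R : Matrix (Fin d₁) (Fin d₁) ℂ)
    (S : Fin d₁ → Matrix (Fin d₂) (Fin d₂) ℂ) (f : Fin d₁ → Fin d₂ → Fin 2 → ℝ) (k : Fin 2)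
    (x : Fin d₁ × Fin d₂ → ℂ) :
    bornProb (oneWayMeasurement R S f k) (proj x) =
      ∑ i, ∑ j, f i j k * ‖star (tensorVec (R.col i) ((S i).col j)) ⬝ᵥ x‖ ^ 2 := by
  rw [bornProb, trace_mul_proj, quadForm_oneWayMeasurement, Complex.ofReal_re]

theorem sum_norm_sq_star_tensorVec_dotProduct {d₁ d₂ : ℕ} {R : Matrix (Fin d₁) (Fin d₁) ℂ}
    {S : Fin d₁ → Matrix (Fin d₂) (Fin d₂) ℂ} (hR : R ∈ Matrix.unitaryGroup (Fin d₁) ℂ)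
    (hS : ∀ i, S i ∈ Matrix.unitaryGroup (Fin d₂) ℂ) {x : Fin d₁ × Fin d₂ → ℂ}
    (hx : IsUnitVec x) :
    ∑ i, ∑ j, ‖star (tensorVec (R.col i) ((S i).col j)) ⬝ᵥ x‖ ^ 2 = 1 := by
  -- Parseval's identity is read off from completeness of the measurement whose label is always 0.
  have h := (isLOCCMeasurement_oneWayMeasurement (f := fun _ _ k => if k = 0 then 1 else 0) hR hS
    (fun _ _ k => by split_ifs <;> norm_num) (fun _ _ => by simp)).add_eq_one
  have h1 := congrArg (fun M => quadForm M x) h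
  simp only [quadForm_add_matrix, quadForm_oneWayMeasurement] at h1
  rw [quadForm, Matrix.one_mulVec, hx] at h1
  simp only [if_true, one_mul, one_ne_zero, if_false, zero_mul, Finset.sum_const_zero,
    Complex.ofReal_zero, add_zero] at h1
  exact_mod_cast h1

theorem bornProb_of_discrimination {n₁ n₂ : ℕ} {x y : Fin n₁ × Fin n₂ → ℂ}
    {R : Matrix (Fin n₁) (Fin n₁) ℂ} {S : Fin n₁ → Matrix (Fin n₂) (Fin n₂) ℂ}
    {g : Fin n₁ → Fin n₂ → Fin 2} (hR : R ∈ Matrix.unitaryGroup (Fin n₁) ℂ)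
    (hS : ∀ i, S i ∈ Matrix.unitaryGroup (Fin n₂) ℂ)
    (hg : ∀ i j, (g i j = 0 → star (tensorVec (R.col i) ((S i).col j)) ⬝ᵥ y = 0) ∧
        (g i j = 1 → star (tensorVec (R.col i) ((S i).col j)) ⬝ᵥ x = 0))
    (hx : IsUnitVec x) (hy : IsUnitVec y) (α β : ℂ) :
    bornProb (oneWayMeasurement R S (fun i j k => if g i j = k then 1 else 0) 0)
      (proj (α • x + β • y)) = ‖α‖ ^ 2 ∧
    bornProb (oneWayMeasurement R S (fun i j k => if g i j = k then 1 else 0) 1)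
      (proj (α • x + β • y)) = ‖β‖ ^ 2 := by
  rw [bornProb_oneWayMeasurement, bornProb_oneWayMeasurement]
  constructor
  · refine Eq.trans ?_ ((congrArg (‖α‖ ^ 2 * ·)
      (sum_norm_sq_star_tensorVec_dotProduct hR hS hx)).trans (mul_one _))
    rw [Finset.mul_sum]
    refine Finset.sum_congr rfl fun i _ => ?_
    rw [Finset.mul_sum]
    refine Finset.sum_congr rfl fun j _ => ?_
    rw [dotProduct_add, dotProduct_smul, dotProduct_smul]
    obtain h | h : g i j = 0 ∨ g i j = 1 := by omega
    · rw [(hg i j).1 h]; simp [h, mul_pow]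
    · rw [(hg i j).2 h]; simp [h]
  · refine Eq.trans ?_ ((congrArg (‖β‖ ^ 2 * ·)
      (sum_norm_sq_star_tensorVec_dotProduct hR hS hy)).trans (mul_one _))
    rw [Finset.mul_sum]
    refine Finset.sum_congr rfl fun i _ => ?_
    rw [Finset.mul_sum]
    refine Finset.sum_congr rfl fun j _ => ?_
    rw [dotProduct_add, dotProduct_smul, dotProduct_smul]
    obtain h | h : g i j = 0 ∨ g i j = 1 := by omega
    · rw [(hg i j).1 h]; simp [h]
    · rw [(hg i j).2 h]; simp [h, mul_pow]

open scoped ComplexOrder in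
theorem norm_star_dotProduct_le_one {ι : Type} [Fintype ι] {x y : ι → ℂ} (hx : IsUnitVec x)
    (hy : IsUnitVec y) : ‖star x ⬝ᵥ y‖ ≤ 1 := by
  classical
  have h := norm_dotProduct_mulVec_le (Matrix.PosSemidef.one (n := ι) (R := ℂ)) x y
  simp only [quadForm, Matrix.one_mulVec] at h
  rw [hx, hy] at h
  simpa using h

open scoped ComplexOrder in
theorem exists_orthonormal_pair {ι : Type} [Fintype ι] [Nontrivial ι] {φ χ : ι → ℂ}
    (hφ : IsUnitVec φ) (hχ : IsUnitVec χ) {z : ℝ} (hz : ‖star χ ⬝ᵥ φ‖ = z) :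
    ∃ (u v : ι → ℂ) (e : ℂ), IsUnitVec u ∧ IsUnitVec v ∧ star u ⬝ᵥ v = 0 ∧ ‖e‖ = 1 ∧
      φ = e • u ∧ χ = (z : ℂ) • u + ((√(1 - z ^ 2) : ℝ) : ℂ) • v := by
  classical
  obtain ⟨e, he, hc⟩ : ∃ e : ℂ, ‖e‖ = 1 ∧ star χ ⬝ᵥ φ = z * e := by
    by_cases h0 : z = 0
    · rw [h0, norm_eq_zero] at hz
      exact ⟨1, by simp, by simp [hz, h0]⟩
    · have hz0 : (z : ℂ) ≠ 0 := by exact_mod_cast h0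
      refine ⟨(star χ ⬝ᵥ φ) / z, ?_, by field_simp⟩
      rw [norm_div, Complex.norm_real, Real.norm_of_nonneg (hz ▸ norm_nonneg _), hz, div_self h0]
  have hee : star e * e = 1 := by
    have := Complex.conj_mul' e
    rw [he] at this
    simpa using this
  -- Removing the phase `e` makes the overlap of `χ` and `u` the real number `z`.
  obtain ⟨u, hu⟩ : ∃ u, u = star e • φ := ⟨_, rfl⟩
  have hφu : φ = e • u := by rw [hu, smul_smul, mul_comm, hee, one_smul]
  have huu : star u ⬝ᵥ u = 1 := by
    rw [hu, star_smul, smul_dotProduct, dotProduct_smul, hφ]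
    simpa [mul_comm] using hee
  have hχu : star χ ⬝ᵥ u = z := by
    rw [hu, dotProduct_smul, hc, smul_eq_mul]
    linear_combination (z : ℂ) * hee
  have huχ : star u ⬝ᵥ χ = z := by
    rw [Matrix.star_dotProduct, hχu, Complex.star_def, Complex.conj_ofReal]
  obtain ⟨w, hw⟩ : ∃ w, w = √(1 - z ^ 2) := ⟨_, rfl⟩
  have hz0 : 0 ≤ z := hz ▸ norm_nonneg _
  have hz1 : z ≤ 1 := hz ▸ norm_star_dotProduct_le_one hχ hφ
  have hww : (w : ℂ) * w = 1 - z * z := by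
    have : w * w = 1 - z * z := by
      rw [hw, Real.mul_self_sqrt (by nlinarith)]; ring
    exact_mod_cast this
  have hd : star (χ - (z : ℂ) • u) ⬝ᵥ (χ - (z : ℂ) • u) = (w : ℂ) * w := by
    rw [star_sub, star_smul, sub_dotProduct, dotProduct_sub, dotProduct_sub, smul_dotProduct,
      smul_dotProduct, dotProduct_smul, dotProduct_smul, hχ, huu, hχu, huχ, hww,
      Complex.star_def, Complex.conj_ofReal]
    simp only [smul_eq_mul]
    ring
  rw [← hw]
  -- If `w = 0`, then `χ` is a multiple of `u` and does not determine `v`; any unit vector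
  -- orthogonal to `u` serves, and one exists because the dimension is at least 2.
  by_cases hw0 : w = 0
  · obtain ⟨i₀, i₁, hi⟩ := exists_pair_ne ι
    obtain ⟨S, hS, hSi⟩ := exists_unitary_extension {i₀} (fun _ => u) (by
      rintro j rfl k rfl
      rw [if_pos rfl]
      exact huu)
    have hcol := (mem_unitaryGroup_iff_col S).1 hS
    refine ⟨u, S.col i₁, e, huu, by rw [IsUnitVec, hcol, if_pos rfl], ?_, he, hφu, ?_⟩
    · rw [← hSi i₀ rfl, hcol, if_neg hi]
    · rw [hw0, Complex.ofReal_zero, zero_mul, dotProduct_star_self_eq_zero] at hd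
      rw [hw0, Complex.ofReal_zero, zero_smul, add_zero]
      exact sub_eq_zero.1 hd
  · have hw0' : (w : ℂ) ≠ 0 := by exact_mod_cast hw0
    refine ⟨u, (w : ℂ)⁻¹ • (χ - (z : ℂ) • u), e, huu, ?_, ?_, he, hφu, ?_⟩
    · rw [IsUnitVec, star_smul, smul_dotProduct, dotProduct_smul, hd, star_inv₀, Complex.star_def,
        Complex.conj_ofReal]
      simp only [smul_eq_mul]
      field_simp
    · rw [dotProduct_smul, dotProduct_sub, dotProduct_smul, huχ, huu]
      simp
    · rw [smul_smul, mul_inv_cancel₀ hw0', one_smul]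
      abel

theorem exists_optimalError_eq {z δ : ℝ} (hz : 0 ≤ z) (hz1 : z ≤ 1) (hδ : 0 ≤ δ) (hδ1 : δ ≤ 1) :
    ∃ c s : ℝ, c ^ 2 + s ^ 2 = 1 ∧ s ^ 2 ≤ δ ∧
      optimalError z δ = (z * c - √(1 - z ^ 2) * s) ^ 2 := by
  have hw : √(1 - z ^ 2) ^ 2 = 1 - z ^ 2 := Real.sq_sqrt (by nlinarith)
  rw [optimalError]
  split_ifs with h
  -- For `z ≤ √δ` the accepting vector can be taken orthogonal to `χ`; the type I error is then `z ^
  -- 2 ≤ δ`.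
  · refine ⟨√(1 - z ^ 2), z, by rw [hw]; ring, ?_, by ring⟩
    rw [← Real.sq_sqrt hδ]
    exact pow_le_pow_left₀ hz h 2
  · exact ⟨√(1 - δ), √δ, by rw [Real.sq_sqrt hδ, Real.sq_sqrt (by linarith)]; ring,
      (Real.sq_sqrt hδ).le, rfl⟩

theorem exists_oneWay_optimal {n₁ n₂ : ℕ} (hn₁ : 1 ≤ n₁) (hn₂ : 1 ≤ n₂)
    {φ χ : Fin n₁ × Fin n₂ → ℂ} (hφ : IsUnitVec φ) (hχ : IsUnitVec χ) {z : ℝ}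
    (hz : ‖star χ ⬝ᵥ φ‖ = z) {δ : ℝ} (hδ : 0 ≤ δ) (hδ1 : δ ≤ 1) :
    ∃ (R : Matrix (Fin n₁) (Fin n₁) ℂ) (S : Fin n₁ → Matrix (Fin n₂) (Fin n₂) ℂ)
      (f : Fin n₁ → Fin n₂ → Fin 2 → ℝ),
      R ∈ Matrix.unitaryGroup (Fin n₁) ℂ ∧ (∀ i, S i ∈ Matrix.unitaryGroup (Fin n₂) ℂ) ∧
      (∀ i j k, 0 ≤ f i j k) ∧ (∀ i j, f i j 0 + f i j 1 = 1) ∧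
      (2 ≤ n₁ * n₂ → ∀ i j k, f i j k = 0 ∨ f i j k = 1) ∧
      (2 ≤ n₂ → ∀ i i', f i = f i') ∧
      IsLOCCMeasurement (oneWayMeasurement R S f) ∧
      bornProb (oneWayMeasurement R S f 1) (proj φ) ≤ δ ∧
      bornProb (oneWayMeasurement R S f 0) (proj χ) = optimalError z δ := by
  by_cases hn : 2 ≤ n₁ * n₂
  · have : Nontrivial (Fin n₁ × Fin n₂) := by
      rw [← Fintype.one_lt_card_iff_nontrivial]
      simpa [Nat.lt_iff_add_one_le] using hn
    obtain ⟨u, v, e, hu, hv, huv, he, hφu, hχu⟩ := exists_orthonormal_pair hφ hχ hz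
    have hz0 : 0 ≤ z := hz ▸ norm_nonneg _
    have hz1 : z ≤ 1 := hz ▸ norm_star_dotProduct_le_one hχ hφ
    obtain ⟨c, s, hcs, hsδ, hopt⟩ := exists_optimalError_eq hz0 hz1 hδ hδ1
    set w := √(1 - z ^ 2)
    have hcs' : (c : ℂ) ^ 2 + (s : ℂ) ^ 2 = 1 := by exact_mod_cast hcs
    have hvu : star v ⬝ᵥ u = 0 := by rw [Matrix.star_dotProduct, huv, star_zero]
    have hdot : ∀ p q r t : ℝ, star ((p : ℂ) • u + (q : ℂ) • v) ⬝ᵥ ((r : ℂ) • u + (t : ℂ) • v) =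
        p * r + q * t := by
      intro p q r t
      rw [star_add, star_smul, star_smul, add_dotProduct, dotProduct_add, dotProduct_add]
      simp only [smul_dotProduct, dotProduct_smul, huv, hvu, smul_eq_mul, Complex.star_def,
        Complex.conj_ofReal]
      rw [hu, hv]
      ring
    -- `x` and `y` are `u` and `v` rotated so that `φ` has weight `s ^ 2` on the rejecting vector
    -- `y`, and `χ` has weight `(z c - w s) ^ 2` on the accepting vector `x`.
    obtain ⟨x, hx⟩ : ∃ x, x = (c : ℂ) • u + ((-s : ℝ) : ℂ) • v := ⟨_, rfl⟩
    obtain ⟨y, hy⟩ : ∃ y, y = (s : ℂ) • u + (c : ℂ) • v := ⟨_, rfl⟩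
    have hxx : IsUnitVec x := by
      rw [IsUnitVec, hx, hdot]
      push_cast
      linear_combination hcs'
    have hyy : IsUnitVec y := by
      rw [IsUnitVec, hy, hdot]
      linear_combination hcs'
    have hxy : star x ⬝ᵥ y = 0 := by
      rw [hx, hy, hdot]
      push_cast
      ring
    have hφx : φ = (e * c) • x + (e * s) • y := by
      rw [hφu, hx, hy]
      ext i
      simp only [Pi.smul_apply, Pi.add_apply, smul_eq_mul]
      push_cast
      linear_combination (-(e * u i)) * hcs'
    have hχx : χ = ((z * c - w * s : ℝ) : ℂ) • x + ((z * s + w * c : ℝ) : ℂ) • y := by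
      rw [hχu, hx, hy]
      ext i
      simp only [Pi.smul_apply, Pi.add_apply, smul_eq_mul]
      push_cast
      linear_combination (-(z * u i + w * v i)) * hcs'
    obtain ⟨R, S, g, hR, hS, hg, hd⟩ := exists_oneWay_discrimination hn hxy
    have h01 : ∀ i j k, (if g i j = k then (1 : ℝ) else 0) = 0 ∨
        (if g i j = k then (1 : ℝ) else 0) = 1 := fun i j k => by split_ifs <;> simp
    have hf : ∀ i j k, (0 : ℝ) ≤ if g i j = k then (1 : ℝ) else 0 := fun i j k => by
      split_ifs <;> norm_num
    have hf1 : ∀ i j, (if g i j = 0 then (1 : ℝ) else 0) + (if g i j = 1 then 1 else 0) = 1 :=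
      fun i j => by
        obtain h | h : g i j = 0 ∨ g i j = 1 := by omega
        all_goals simp [h]
    refine ⟨R, S, fun i j k => if g i j = k then 1 else 0, hR, hS, hf, hf1, fun _ => h01,
      fun h i i' => by dsimp only; rw [hg h i i'],
      isLOCCMeasurement_oneWayMeasurement hR hS hf hf1, ?_, ?_⟩
    · rw [hφx, (bornProb_of_discrimination hR hS hd hxx hyy _ _).2, norm_mul, he, one_mul,
        Complex.norm_real, Real.norm_eq_abs, sq_abs]
      exact hsδ
    · rw [hχx, (bornProb_of_discrimination hR hS hd hxx hyy _ _).1, hopt, Complex.norm_real,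
        Real.norm_eq_abs, sq_abs]
  -- In total dimension 1 the two states coincide up to phase, so `z = 1` and the test is a biased
  -- coin that rejects with probability `δ`.
  · obtain ⟨rfl, rfl⟩ : n₁ = 1 ∧ n₂ = 1 := by
      have := Nat.le_mul_of_pos_right n₁ hn₂
      have := Nat.le_mul_of_pos_left n₂ hn₁
      omega
    have hnorm : ∀ {x : Fin 1 × Fin 1 → ℂ}, IsUnitVec x → ‖x (0, 0)‖ = 1 := by
      intro x hx
      have h := (star_dotProduct_self x).symm.trans hx
      rw [Fintype.sum_prod_type, Fin.sum_univ_one, Fin.sum_univ_one] at h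
      have h' : ‖x (0, 0)‖ ^ 2 = 1 := by exact_mod_cast h
      exact (pow_eq_one_iff_of_nonneg (norm_nonneg _) two_ne_zero).1 h'
    have hz1 : z = 1 := by
      rw [← hz, dotProduct, Fintype.sum_prod_type, Fin.sum_univ_one, Fin.sum_univ_one, norm_mul,
        Pi.star_apply, norm_star, hnorm hφ, hnorm hχ, one_mul]
    have hborn : ∀ k {x : Fin 1 × Fin 1 → ℂ}, IsUnitVec x →
        bornProb (oneWayMeasurement 1 (fun _ => 1) (fun _ _ k => if k = 0 then 1 - δ else δ) k)
          (proj x) = if k = 0 then 1 - δ else δ := by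
      intro k x hx
      rw [bornProb_oneWayMeasurement]
      simp only [← Finset.mul_sum]
      rw [sum_norm_sq_star_tensorVec_dotProduct (one_mem _) (fun _ => one_mem _) hx, mul_one]
    have hf : ∀ (_ _ : Fin 1) (k : Fin 2), 0 ≤ if k = 0 then 1 - δ else δ := fun _ _ k => by
      split_ifs <;> linarith
    refine ⟨1, fun _ => 1, fun _ _ k => if k = 0 then 1 - δ else δ, one_mem _, fun _ => one_mem _,
      hf, fun _ _ => by simp, fun h => absurd h (by norm_num), fun h => absurd h (by norm_num),
      isLOCCMeasurement_oneWayMeasurement (one_mem _) (fun _ => one_mem _) hf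
        (fun _ _ => by simp), ?_, ?_⟩
    · rw [hborn 1 hφ]; simp
    · rw [hborn 0 hχ, if_pos rfl, hz1, optimalError]
      split_ifs with h
      · have : 1 ≤ δ := by
          have := pow_le_pow_left₀ zero_le_one h 2
          rwa [Real.sq_sqrt hδ, one_pow] at this
        linarith
      · simp [Real.sq_sqrt (sub_nonneg.2 hδ1)]

theorem isUnitVec_tensorVec {a b : ℕ} {x : Fin a → ℂ} {y : Fin b → ℂ} (hx : IsUnitVec x)
    (hy : IsUnitVec y) : IsUnitVec (tensorVec x y) := by
  rw [IsUnitVec, tensorVec_dotProduct_tensorVec, hx, hy, one_mul]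

theorem star_mulVec_dotProduct_mulVec {ι : Type} [Fintype ι] (U V : Matrix ι ι ℂ) (x : ι → ℂ) :
    star (V *ᵥ x) ⬝ᵥ (U *ᵥ x) = quadForm (Vᴴ * U) x := by
  rw [quadForm, ← Matrix.mulVec_mulVec, Matrix.star_mulVec, Matrix.dotProduct_mulVec (star x)]

theorem isUnitVec_mulVec {ι : Type} [Fintype ι] [DecidableEq ι] {U : Matrix ι ι ℂ}
    (hU : Uᴴ * U = 1) {x : ι → ℂ} (hx : IsUnitVec x) : IsUnitVec (U *ᵥ x) := by
  rw [IsUnitVec, star_mulVec_dotProduct_mulVec, hU, quadForm, Matrix.one_mulVec, hx]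

/-- The optimal error is reached with trivial auxiliary systems. -/
theorem optimalError_mem_typeIIErrors {d₁ d₂ : ℕ} (hd₁ : 1 ≤ d₁) (hd₂ : 1 ≤ d₂)
    {U V : BiOp d₁ d₂} (hU : U ∈ Matrix.unitaryGroup (Fin d₁ × Fin d₂) ℂ)
    (hV : V ∈ Matrix.unitaryGroup (Fin d₁ × Fin d₂) ℂ) {a : Fin d₁ → ℂ} {b : Fin d₂ → ℂ}
    (ha : IsUnitVec a) (hb : IsUnitVec b) {δ : ℝ} (hδ : 0 ≤ δ) (hδ1 : δ ≤ 1) :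
    optimalError ‖quadForm (Vᴴ * U) (tensorVec a b)‖ δ ∈ typeIIErrors U V δ := by
  have hunit : ∀ {d : ℕ} {x : Fin d → ℂ}, IsUnitVec x →
      -- The auxiliary systems have dimension 1, so `a` and `b` are carried over to the index types
      -- `Fin (d * 1)`.
      IsUnitVec fun k : Fin (d * 1) => x (finProdFinEquiv.symm k).1 := by
    intro d x hx
    rw [IsUnitVec, dotProduct, ← finProdFinEquiv.sum_comp, Fintype.sum_prod_type]
    simp only [Equiv.symm_apply_apply, Pi.star_apply, Fin.sum_univ_one]
    exact hx
  set e := regroup d₁ d₂ 1 1 with he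
  set ψ := tensorVec (fun k : Fin (d₁ * 1) => a (finProdFinEquiv.symm k).1)
    (fun k : Fin (d₂ * 1) => b (finProdFinEquiv.symm k).1) with hψ
  have hψ1 : IsUnitVec ψ := isUnitVec_tensorVec (hunit ha) (hunit hb)
  have hext : ∀ W : BiOp d₁ d₂, W ∈ Matrix.unitaryGroup (Fin d₁ × Fin d₂) ℂ →
      IsUnitVec (Matrix.reindex e e (W ⊗ₖ 1) *ᵥ ψ) := by
    intro W hW
    refine isUnitVec_mulVec ?_ hψ1
    have hWW : Wᴴ * W = 1 := Matrix.mem_unitaryGroup_iff'.1 hW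
    rw [reindex_mul_conjTranspose, hWW, Matrix.one_kronecker_one]
    simp
  have hover : star (Matrix.reindex e e (V ⊗ₖ 1) *ᵥ ψ) ⬝ᵥ (Matrix.reindex e e (U ⊗ₖ 1) *ᵥ ψ) =
      quadForm (Vᴴ * U) (tensorVec a b) := by
    rw [star_mulVec_dotProduct_mulVec, reindex_mul_conjTranspose, hψ, he,
      quadForm_extension_tensorVec]
    simp
  obtain ⟨R, S, f, -, -, -, -, -, -, hL, hI, hII⟩ := exists_oneWay_optimal (by omega) (by omega)
    (hext U hU) (hext V hV) (congrArg norm hover) hδ hδ1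
  refine ⟨1, 1, proj ψ, oneWayMeasurement R S f,
    isLOCCState_proj_tensorVec (hunit ha) (hunit hb), hL, ?_, ?_⟩
  · rwa [extendedChannel_eq, mul_proj_mul_conjTranspose]
  · rw [extendedChannel_eq, mul_proj_mul_conjTranspose]
    exact hII.symm

end LocalCertification

theorem theorem1 (d₁ d₂ : ℕ) (hd₁ : 1 ≤ d₁) (hd₂ : 1 ≤ d₂)
    (U V : Matrix (Fin d₁ × Fin d₂) (Fin d₁ × Fin d₂) ℂ)
    (hU : U ∈ Matrix.unitaryGroup (Fin d₁ × Fin d₂) ℂ)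
    (hV : V ∈ Matrix.unitaryGroup (Fin d₁ × Fin d₂) ℂ) :
    -- the distance `z` is attained
    IsLeast ((fun w : ℂ => ‖w‖) '' LocalCertification.productNumericalRange (Vᴴ * U))
      (LocalCertification.distToZero (Vᴴ * U)) ∧
    -- the optimal type II error, over LOCC states and measurements with arbitrary ancillas
    (∀ δ : ℝ, 0 ≤ δ → δ ≤ 1 →
      IsLeast (LocalCertification.typeIIErrors U V δ)
        (LocalCertification.optimalError (LocalCertification.distToZero (Vᴴ * U)) δ)) ∧
    -- it is attained without ancillas, from every pure product state that minimizes
    -- `|⟨a,b|V†U|a,b⟩|` (whatever `δ` is), by a measurement with one-way communication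
    (∀ (a : Fin d₁ → ℂ) (b : Fin d₂ → ℂ),
      LocalCertification.IsUnitVec a → LocalCertification.IsUnitVec b →
      ‖LocalCertification.quadForm (Vᴴ * U) (LocalCertification.tensorVec a b)‖ =
        LocalCertification.distToZero (Vᴴ * U) →
      LocalCertification.IsLOCCState
        (LocalCertification.proj (LocalCertification.tensorVec a b)) ∧
      ∀ δ : ℝ, 0 ≤ δ → δ ≤ 1 →
        ∃ (R : Matrix (Fin d₁) (Fin d₁) ℂ) (S : Fin d₁ → Matrix (Fin d₂) (Fin d₂) ℂ)
          (f : Fin d₁ → Fin d₂ → Fin 2 → ℝ),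
          R ∈ Matrix.unitaryGroup (Fin d₁) ℂ ∧
          (∀ i, S i ∈ Matrix.unitaryGroup (Fin d₂) ℂ) ∧
          (∀ i j k, 0 ≤ f i j k) ∧ (∀ i j, f i j 0 + f i j 1 = 1) ∧
          -- no randomness is needed unless `d₁ = d₂ = 1`
          (2 ≤ d₁ * d₂ → ∀ i j k, f i j k = 0 ∨ f i j k = 1) ∧
          -- Bob's outcome alone decides unless `d₂ = 1`
          (2 ≤ d₂ → ∀ i i', f i = f i') ∧
          LocalCertification.IsLOCCMeasurement
            (LocalCertification.oneWayMeasurement R S f) ∧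
          LocalCertification.bornProb (LocalCertification.oneWayMeasurement R S f 1)
            (LocalCertification.unitaryChannel U
              (LocalCertification.proj (LocalCertification.tensorVec a b))) ≤ δ ∧
          LocalCertification.bornProb (LocalCertification.oneWayMeasurement R S f 0)
            (LocalCertification.unitaryChannel V
              (LocalCertification.proj (LocalCertification.tensorVec a b))) =
            LocalCertification.optimalError
              (LocalCertification.distToZero (Vᴴ * U)) δ) := by
  obtain ⟨⟨_, ⟨a₀, b₀, ha₀, hb₀, rfl⟩, hz₀⟩, hmin⟩ :=
    LocalCertification.isLeast_distToZero hd₁ hd₂ (Vᴴ * U)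
  refine ⟨LocalCertification.isLeast_distToZero hd₁ hd₂ (Vᴴ * U), fun δ hδ hδ1 => ⟨?_, fun p hp =>
    LocalCertification.optimalError_le_of_mem_typeIIErrors hU hV hδ1 hp⟩, fun a b ha hb hz =>
    ⟨LocalCertification.isLOCCState_proj_tensorVec ha hb, fun δ hδ hδ1 => ?_⟩⟩
  · rw [← hz₀]
    exact LocalCertification.optimalError_mem_typeIIErrors hd₁ hd₂ hU hV ha₀ hb₀ hδ hδ1
  · have hψ := LocalCertification.isUnitVec_tensorVec ha hb
    have hover := LocalCertification.star_mulVec_dotProduct_mulVec U V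
      (LocalCertification.tensorVec a b)
    simp only [LocalCertification.unitaryChannel, LocalCertification.mul_proj_mul_conjTranspose]
    exact LocalCertification.exists_oneWay_optimal hd₁ hd₂
      (LocalCertification.isUnitVec_mulVec (Matrix.mem_unitaryGroup_iff'.1 hU) hψ)
      (LocalCertification.isUnitVec_mulVec (Matrix.mem_unitaryGroup_iff'.1 hV) hψ)
      (by rw [hover, hz]) hδ hδ1
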